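/- Let $M=\langle M,\in^M\rangle$ be a model of $\mathrm{ZF}$, that is, any first-order structure in the language $\{\in\}$ of set theory that satisfies all axioms of $\mathrm{ZF}$ (it need not be well-founded or countable). An element $a\in M$ is \emph{definable} in $M$ if there is a first-order formula $\varphi(x)$ without parameters such that $a$ is the only $b\in M$ with $M\models\varphi[b]$, and \emph{algebraic} in $M$ if there is a first-order formula $\varphi(x)$ without parameters such that $\{b\in M\mid M\models\varphi[b]\}$ is a finite set containing $a$. Suppose that $M$ is pointwise algebraic, that is, every element of $M$ is algebraic in $M$. Then $M$ is pointwise definable, that is, every element of $M$ is definable in $M$; and moreover $M\models\mathrm{ZFC}+V=\mathrm{HOD}$. Here $V=\mathrm{HOD}$ is the sentence of set theory saying that every set is hereditarily ordinal definable, where a set $a$ is \emph{ordinal definable} if for some ordinal $\theta$ it is the unique element of $V_\theta$ satisfying in the structure $\langle V_\theta,\in\rangle$ some (coded) first-order formula with finitely many ordinal parameters below $\theta$, and \emph{hereditarily ordinal definable} if $a$ and all elements of its transitive closure are ordinal definable. -/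

import Mathlib

open FirstOrder FirstOrder.Language

namespace SetModel

/-! ### The language of set theory -/

/-- The only non-logical symbol is the binary relation symbol of membership. -/
inductive MemRel : ℕ → Type
  | mem : MemRel 2

/-- The first-order language (with equality) of set theory. -/
def setLang : FirstOrder.Language.{0, 0} := ⟨fun _ => Empty, MemRel⟩

/-! ### Definable and algebraic elements of a structure -/

section Pointwise

variable (L : FirstOrder.Language.{0, 0}) (M : Type*) [L.Structure M]

/-- `a` is definable without parameters: `{a}` is the solution set of a first-order formula. -/
def DefinableElement {M : Type*} [L.Structure M] (a : M) : Prop :=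
  (∅ : Set M).Definable₁ L {a}

/-- `a` is algebraic without parameters: it lies in the solution set of a parameter-free
first-order formula which has only finitely many solutions. -/
def AlgebraicElement {M : Type*} [L.Structure M] (a : M) : Prop :=
  ∃ s : Set M, (∅ : Set M).Definable₁ L s ∧ s.Finite ∧ a ∈ s

def PointwiseDefinable : Prop := ∀ a : M, DefinableElement L a

def PointwiseAlgebraic : Prop := ∀ a : M, AlgebraicElement L a

end Pointwise

/-! ### Writing formulas of set theory

A formula whose free variables are numbered `0, …, n - 1` has type `Fm n`. A quantifier binds the
variable number `n`; `all fun x => φ` and `ex fun x => φ` give it the name `x` in `φ`. A variable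
`x` from outside is written `x↟` below one further quantifier. -/

/-- Formulas of set theory in the free variables `0, …, n - 1`. -/
abbrev Fm (n : ℕ) : Type := setLang.BoundedFormula Empty n

postfix:max "↟" => Fin.castSucc

section Formulas

variable {n : ℕ}

def all (φ : Fin (n + 1) → Fm (n + 1)) : Fm n := (φ (Fin.last n)).all

def ex (φ : Fin (n + 1) → Fm (n + 1)) : Fm n := (φ (Fin.last n)).ex

/-- `x ∈ y` -/
def mem (x y : Fin n) : Fm n :=
  Relations.boundedFormula₂ (L := setLang) MemRel.mem (Term.var (Sum.inr x)) (Term.var (Sum.inr y))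

/-- `x = y` -/
def eq (x y : Fin n) : Fm n :=
  Term.bdEqual (Term.var (Sum.inr x)) (Term.var (Sum.inr y))

/-- `∀ x ∈ a, φ` -/
def allIn (a : Fin n) (φ : Fin (n + 1) → Fm (n + 1)) : Fm n :=
  all fun x => mem x a↟ ⟹ φ x

/-- `∃ x ∈ a, φ` -/
def exIn (a : Fin n) (φ : Fin (n + 1) → Fm (n + 1)) : Fm n :=
  ex fun x => mem x a↟ ⊓ φ x

/-- `x ⊆ y` -/
def subset (x y : Fin n) : Fm n := allIn x fun z => mem z y↟

/-- `x = ∅` -/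
def isEmpty (x : Fin n) : Fm n := all fun z => ∼(mem z x↟)

/-- `z = {x, y}` -/
def isUPair (z x y : Fin n) : Fm n :=
  all fun w => mem w z↟ ⇔ (eq w x↟ ⊔ eq w y↟)

/-- `z = ⟨x, y⟩ = {{x}, {x, y}}` -/
def isPair (z x y : Fin n) : Fm n :=
  ex fun p => ex fun q =>
    isUPair p↟ x↟↟ x↟↟ ⊓ (isUPair q x↟↟ y↟↟ ⊓ isUPair z↟↟ p↟ q)

/-- `y = x ∪ {x}` -/
def isSucc (y x : Fin n) : Fm n :=
  all fun w => mem w y↟ ⇔ (mem w x↟ ⊔ eq w x↟)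

/-- `x` is a transitive set. -/
def isTrans (x : Fin n) : Fm n := allIn x fun y => subset y x↟

/-- `x` is an ordinal: a transitive set of transitive sets (the axiom of foundation is in force). -/
def isOrd (x : Fin n) : Fm n := isTrans x ⊓ allIn x fun y => isTrans y

/-- `x` is empty or a successor. -/
def isZeroOrSucc (x : Fin n) : Fm n := isEmpty x ⊔ ex fun y => isSucc x↟ y

/-- `x` is a natural number: an ordinal such that it and all its elements are zero or
successors. -/
def isNat (x : Fin n) : Fm n :=
  isOrd x ⊓ (isZeroOrSucc x ⊓ allIn x fun y => isZeroOrSucc y)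

/-- `x` is the natural number `k`. -/
def isNum : ℕ → {n : ℕ} → Fin n → Fm n
  | 0, _, x => isEmpty x
  | k + 1, _, x => ex fun y => isNum k y ⊓ isSucc x↟ y

/-- `⟨x, y⟩ ∈ r`; for a function `r` this says `r(x) = y`. -/
def app (r x y : Fin n) : Fm n := exIn r fun z => isPair z x↟ y↟

/-- The formula `φ` with each free variable `i` replaced by the variable `g i`. -/
def inst {α : Type} (φ : setLang.Formula α) (g : α → Fin n) : Fm n :=
  BoundedFormula.relabel (fun i => Sum.inr (g i)) φ

/-! ### The axioms of ZF and ZFC -/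

def extensionality : setLang.Sentence :=
  all fun x => all fun y => (all fun z => mem z x↟↟ ⇔ mem z y↟) ⟹ eq x↟ y

def foundation : setLang.Sentence :=
  all fun x => (∼(isEmpty x)) ⟹ exIn x fun y => ∼(exIn y fun z => mem z x↟↟)

def pairing : setLang.Sentence :=
  all fun x => all fun y => ex fun z => isUPair z x↟↟ y↟

def union : setLang.Sentence :=
  all fun x => ex fun u => all fun z => mem z u↟ ⇔ exIn x↟↟ fun y => mem z↟ y

def powerSet : setLang.Sentence :=
  all fun x => ex fun p => all fun z => mem z p↟ ⇔ subset z x↟↟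

def infinity : setLang.Sentence :=
  ex fun w => (exIn w fun z => isEmpty z) ⊓
    allIn w fun x => exIn w↟ fun y => isSucc y x↟

/-- Separation for `φ(p, x)`: for all parameters `p = (p₀, …, pₖ₋₁)` and every set `a` there is a
set `b` whose elements are exactly the `x ∈ a` with `φ(p, x)`. -/
def separation {k : ℕ} (φ : setLang.Formula (Fin k ⊕ Fin 1)) : setLang.Sentence :=
  BoundedFormula.alls (n := k) <| all fun a => ex fun b => all fun x =>
    mem x b↟ ⇔ (mem x a↟↟ ⊓ inst φ (Sum.elim (fun i => i↟↟↟) ![x]))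

/-- Replacement for `φ(p, x, y)`: for all parameters `p = (p₀, …, pₖ₋₁)` and every set `a`, if each
`x ∈ a` has at most one `y` with `φ(p, x, y)`, then there is a set `b` whose elements are exactly
the `y` such that `φ(p, x, y)` for some `x ∈ a`. -/
def replacement {k : ℕ} (φ : setLang.Formula (Fin k ⊕ Fin 2)) : setLang.Sentence :=
  BoundedFormula.alls (n := k) <| all fun a =>
    (allIn a fun x => all fun y => all fun z =>
      (inst φ (Sum.elim (fun i => i↟↟↟↟) ![x↟↟, y↟]) ⊓
        inst φ (Sum.elim (fun i => i↟↟↟↟) ![x↟↟, z])) ⟹ eq y↟ z) ⟹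
    ex fun b => all fun y =>
      mem y b↟ ⇔ exIn a↟↟ fun x => inst φ (Sum.elim (fun i => i↟↟↟↟) ![x, y↟])

/-- Choice: every set of pairwise disjoint nonempty sets has a transversal. -/
def choice : setLang.Sentence :=
  all fun a =>
    ((allIn a fun x => ∼(isEmpty x)) ⊓
      (allIn a fun x => allIn a↟ fun y =>
        (ex fun z => mem z x↟↟ ⊓ mem z y↟) ⟹ eq x↟ y)) ⟹
    ex fun c => allIn a↟ fun x => ex fun z => all fun w =>
      (mem w x↟↟ ⊓ mem w c↟↟↟) ⇔ eq w z↟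

/-! ### Ordinal definability, as a notion formalized in the language of set theory -/

/-- `h` is a function with domain `d`. -/
def isFunOn (h d : Fin n) : Fm n :=
  (allIn h fun z => exIn d↟ fun x => ex fun y => isPair z↟↟ x↟ y) ⊓
    allIn d fun x => ex fun y => all fun w => app h↟↟↟ x↟↟ w ⇔ eq w y↟

/-- `v = V_θ` for the ordinal `θ`: there is a function `h` on an ordinal `d` with `θ ∈ d` such that
`h(β) = ⋃_{γ < β} 𝒫(h(γ))` for all `β ∈ d`, and `v = h(θ)`. -/
def isV (v θ : Fin n) : Fm n :=
  ex fun d => ex fun h =>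
    isOrd d↟ ⊓ (mem θ↟↟ d↟ ⊓ (isFunOn h d↟ ⊓ (app h θ↟↟ v↟↟ ⊓
      allIn d↟ fun β => all fun y => app h↟↟ β↟ y ⟹
        all fun x => mem x y↟ ⇔
          exIn β↟↟ fun γ => ex fun z => app h↟↟↟↟↟ γ↟ z ⊓ subset x↟↟ z)))

/-- `p = ⟨k, ⟨x, y⟩⟩` for the natural number `k`. -/
def isTriple (k : ℕ) (p x y : Fin n) : Fm n :=
  ex fun t => ex fun u => isNum k t↟ ⊓ (isPair u x↟↟ y↟↟ ⊓ isPair p↟↟ t↟ u)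

/-! Formulas of set theory are coded by sets as follows, where `i`, `j` are natural numbers:
`∅` codes falsity, `⟨0, ⟨i, j⟩⟩` codes `vᵢ ∈ vⱼ`, `⟨1, ⟨i, j⟩⟩` codes `vᵢ = vⱼ`, `⟨2, ⟨p, q⟩⟩` codes
`p → q`, and `⟨3, ⟨i, p⟩⟩` codes `∀ vᵢ, p`. -/

/-- `F` is a set of codes of formulas which is closed under subformulas. (By foundation, a set
each element of which is the code of an atomic formula, or is composed in one of the above ways of
elements of the set, contains only codes of formulas.) -/
def isFormulaSet (F : Fin n) : Fm n :=
  allIn F fun p => isEmpty p ⊔ ex fun x => ex fun y =>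
    ((isTriple 0 p↟↟ x↟ y ⊔ isTriple 1 p↟↟ x↟ y) ⊓ (isNat x↟ ⊓ isNat y)) ⊔
      ((isTriple 2 p↟↟ x↟ y ⊓ (mem x↟ F↟↟↟ ⊓ mem y F↟↟↟)) ⊔
        (isTriple 3 p↟↟ x↟ y ⊓ (isNat x↟ ⊓ mem y F↟↟↟)))

/-- `s` is a function from the set of natural numbers to `A`, that is, an assignment of values in
`A` to the variables `v₀, v₁, …`. -/
def isAssignment (s A : Fin n) : Fm n :=
  (allIn s fun z => ex fun i => exIn A↟↟ fun y => isNat i↟ ⊓ isPair z↟↟ i↟ y) ⊓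
    all fun i => isNat i ⟹ ex fun y => all fun w => app s↟↟↟ i↟↟ w ⇔ eq w y↟

/-- The assignments `s` and `t` agree at all variables other than `vᵢ`. -/
def agreeOff (s t i : Fin n) : Fm n :=
  all fun j => (isNat j ⊓ ∼(eq j i↟)) ⟹
    all fun y => app s↟↟ j↟ y ⇔ app t↟↟ j↟ y

/-- `T` is a satisfaction relation of the structure `(A, ∈)` for the formulas in `F`: the pairs
`⟨p, s⟩ ∈ T` obey Tarski's clauses for all `p ∈ F` and all assignments `s` in `A`. -/
def isSatRel (A F T : Fin n) : Fm n :=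
  allIn F fun p => all fun s => isAssignment s A↟↟ ⟹
    ((isEmpty p↟ ⟹ ∼(app T↟↟ p↟ s)) ⊓
      all fun x => all fun y =>
        (isTriple 0 p↟↟↟ x↟ y ⟹ (app T↟↟↟↟ p↟↟↟ s↟↟ ⇔
          ex fun a => ex fun b =>
            app s↟↟↟↟ x↟↟↟ a↟ ⊓ (app s↟↟↟↟ y↟↟ b ⊓ mem a↟ b))) ⊓
        ((isTriple 1 p↟↟↟ x↟ y ⟹ (app T↟↟↟↟ p↟↟↟ s↟↟ ⇔
          ex fun a => ex fun b =>
            app s↟↟↟↟ x↟↟↟ a↟ ⊓ (app s↟↟↟↟ y↟↟ b ⊓ eq a↟ b))) ⊓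
        ((isTriple 2 p↟↟↟ x↟ y ⟹ (app T↟↟↟↟ p↟↟↟ s↟↟ ⇔
          (app T↟↟↟↟ x↟ s↟↟ ⟹ app T↟↟↟↟ y s↟↟))) ⊓
        (isTriple 3 p↟↟↟ x↟ y ⟹ (app T↟↟↟↟ p↟↟↟ s↟↟ ⇔
          all fun t => (isAssignment t A↟↟↟↟↟ ⊓ agreeOff s↟↟↟ t x↟↟) ⟹
            app T↟↟↟↟↟ y↟ t)))))

/-- `f` is the code of a formula and `(A, ∈) ⊨ f[s]`. -/
def sat (A f s : Fin n) : Fm n :=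
  ex fun F => ex fun T => mem f↟↟ F↟ ⊓ (isFormulaSet F↟ ⊓ (isSatRel A↟↟ F↟ T ⊓ app T f↟↟ s↟↟))

/-- `s` vanishes at all but finitely many natural numbers. -/
def finSupport (s : Fin n) : Fm n :=
  ex fun m => isNat m ⊓ all fun i => all fun y =>
    (isNat i↟ ⊓ (∼(mem i↟ m↟↟) ⊓ app s↟↟↟ i↟ y)) ⟹ isEmpty y

/-- `a` is ordinal definable: for some ordinal `θ`, the set `a` is the unique `x ∈ V_θ` with
`(V_θ, ∈) ⊨ f[x, s(1), s(2), …]`, for some code `f` of a formula and some finitely many ordinal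
parameters `s(1), s(2), …` below `θ` (all but finitely many of the `s(i)` being `0`). -/
def isOD (a : Fin n) : Fm n :=
  ex fun θ => ex fun v => ex fun f => ex fun s =>
    isOrd θ↟↟↟ ⊓ (isV v↟↟ θ↟↟↟ ⊓ (isAssignment s θ↟↟↟ ⊓ (finSupport s ⊓ (mem a↟↟↟↟ v↟↟ ⊓
      all fun o => all fun t =>
        (isEmpty o↟ ⊓ (isAssignment t v↟↟↟↟ ⊓ agreeOff s↟↟ t o↟)) ⟹
          (sat v↟↟↟↟ f↟↟↟ t ⇔ app t o↟ a↟↟↟↟↟↟)))))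

/-- `a` is hereditarily ordinal definable: `a` and all elements of its transitive closure are
ordinal definable, that is, `a` belongs to a transitive set of ordinal definable sets. -/
def isHOD (a : Fin n) : Fm n :=
  ex fun t => isTrans t ⊓ (mem a↟ t ⊓ allIn t fun x => isOD x)

/-- The sentence `V = HOD`. -/
def VeqHOD : setLang.Sentence := all fun a => isHOD a

end Formulas

/-! ### The theories -/

def ZF : setLang.Theory :=
  {extensionality, foundation, pairing, union, powerSet, infinity} ∪
    {σ | ∃ (k : ℕ) (φ : setLang.Formula (Fin k ⊕ Fin 1)), σ = separation φ} ∪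
    {σ | ∃ (k : ℕ) (φ : setLang.Formula (Fin k ⊕ Fin 2)), σ = replacement φ}

def ZFC : setLang.Theory := ZF ∪ {choice}

end SetModel

/-! The core is a parameter-free definable relation `IsIndex α x` under which an ordinal `α`
determines at most one set `x`, and for which every definable element of `M` has an index. It comes
from a function `enum` on the ordinals: each stage lists the first set not yet listed that one of
the operations `truthOp` produces, and these operations mimic the atomic formulas, implication and
quantification over a level `V l`. Candidates are ordered by their level first. If some result at
level `l` were never listed, then from some stage on only new sets of assignments in `V l` would be
listed, injecting a tail of the ordinals into a set. Hence the range is closed under the operations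
(`exists_enum_eq`), and the truth set in `V l` of every standard formula is listed
(`exists_enum_sat`). By reflection a definable element is definable in some `V θ`
(`exists_pf_of_dfn`), so it has an index.

Let `N` be finite and definable, such that all elements of its members have indices. If `N` has two
distinct members, some indexed set lies in one member and not in another. The least index of such a
set is definable and splits `N` into two smaller definable sets, so by induction every member of `N`
is definable (`dfn_of_finite`). Suppose now that some set has no index and take an `∈`-minimal one,
`a`. It lies in a finite definable set, which may be cut down to those members whose elements all
have indices. Then `a` is definable and so has an index, a contradiction (`exists_isIndex`). Thus
all sets have indices, and `dfn_of_finite` applies to every finite definable set, which gives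
pointwise definability.

Choice follows by taking elements of least index. For `V = HOD`, each element is definable in some
`V θ` by a standard formula without parameters, and for standard formulas the internal satisfaction
relation agrees with the external one (`codeSat_code_iff`). Since `M` may be ill-founded, induction
and recursion inside it are available only for definable classes; the classes `Dfn` and `DfnTerm`
let instance search check definability. -/

namespace SetModel

universe u

/-! ### Calculus of definable predicates and terms -/

section Framework

variable {M : Type u} [setLang.Structure M]

/-- Membership in the structure `M`. -/
def E (x y : M) : Prop := Structure.RelMap (L := setLang) MemRel.mem ![x, y]

infix:50 " ε " => E

/-- `P` is definable in `M` with parameters from `A`. -/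
class Dfn (A : Set M) (P : (ℕ → M) → Prop) : Prop where
  out : ∃ φ : setLang.Formula (A ⊕ ℕ), ∀ v, φ.Realize (Sum.elim (fun a => a.1) v) ↔ P v

/-- The function `t` has a graph that is definable in `M` with parameters from `A`. -/
class DfnTerm (A : Set M) (t : (ℕ → M) → M) : Prop where
  graph : Dfn A fun v => v 0 = t fun n => v (n + 1)

variable {A : Set M}

theorem Dfn.congr {P Q : (ℕ → M) → Prop} (h : Dfn A P) (e : ∀ v, P v ↔ Q v) : Dfn A Q := by
  obtain ⟨φ, hφ⟩ := h.out
  exact ⟨φ, fun v => (hφ v).trans (e v)⟩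

theorem Dfn.rename {P : (ℕ → M) → Prop} (h : Dfn A P) (f : ℕ → ℕ) :
    Dfn A fun v => P fun n => v (f n) := by
  obtain ⟨φ, hφ⟩ := h.out
  refine ⟨φ.relabel (Sum.map id f), fun v => ?_⟩
  rw [Formula.realize_relabel, ← hφ]
  apply iff_of_eq; congr 1; funext i; cases i <;> rfl

instance Dfn.not {P : (ℕ → M) → Prop} [h : Dfn A P] : Dfn A fun v => ¬ P v := by
  obtain ⟨φ, hφ⟩ := h.out
  exact ⟨φ.not, fun v => by rw [Formula.realize_not, hφ]⟩

instance Dfn.imp {P Q : (ℕ → M) → Prop} [h : Dfn A P] [h' : Dfn A Q] :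
    Dfn A fun v => P v → Q v := by
  obtain ⟨φ, hφ⟩ := h.out
  obtain ⟨ψ, hψ⟩ := h'.out
  exact ⟨φ.imp ψ, fun v => by rw [Formula.realize_imp, hφ, hψ]⟩

instance Dfn.and {P Q : (ℕ → M) → Prop} [Dfn A P] [Dfn A Q] : Dfn A fun v => P v ∧ Q v :=
  (inferInstance : Dfn A fun v => ¬ (P v → ¬ Q v)).congr fun v => by tauto

instance Dfn.or {P Q : (ℕ → M) → Prop} [Dfn A P] [Dfn A Q] : Dfn A fun v => P v ∨ Q v :=
  (inferInstance : Dfn A fun v => ¬ P v → Q v).congr fun v => by tauto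

instance Dfn.iff {P Q : (ℕ → M) → Prop} [Dfn A P] [Dfn A Q] : Dfn A fun v => P v ↔ Q v :=
  (inferInstance : Dfn A fun v => (P v → Q v) ∧ (Q v → P v)).congr fun v => by tauto

instance Dfn.false : Dfn A fun _ => False := ⟨⊥, fun _ => by rw [Formula.realize_bot]⟩

instance Dfn.true : Dfn A fun _ => True := ⟨⊤, fun _ => by rw [Formula.realize_top]⟩

/-- The bound variable takes number 0 and the others are shifted, as with de Bruijn indices. With
the body in this form instance search can pass through quantifiers. -/
instance Dfn.all {P : (ℕ → M) → M → Prop} [h : Dfn A fun v => P (fun n => v (n + 1)) (v 0)] :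
    Dfn A fun v => ∀ x, P v x := by
  obtain ⟨φ, hφ⟩ := h.out
  let g : A ⊕ ℕ → (A ⊕ ℕ) ⊕ Fin 1 := Sum.elim (fun a => Sum.inl (Sum.inl a))
    fun n => n.casesOn (Sum.inr 0) fun m => Sum.inl (Sum.inr m)
  refine ⟨(BoundedFormula.relabel (k := 0) g φ).all, fun v => ?_⟩
  refine forall_congr' fun x => ?_
  refine BoundedFormula.realize_relabel.trans ?_
  refine Iff.trans ?_ (hφ fun n => n.casesOn x v)
  unfold Formula.Realize
  apply iff_of_eq; congr 1
  · funext i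
    rcases i with a | n
    · rfl
    · cases n
      · simp [g, Fin.snoc]
      · rfl
  · funext i; exact i.elim0

instance Dfn.ex {P : (ℕ → M) → M → Prop} [h : Dfn A fun v => P (fun n => v (n + 1)) (v 0)] :
    Dfn A fun v => ∃ x, P v x :=
  have : Dfn A fun v => ¬ P (fun n => v (n + 1)) (v 0) := inferInstance
  (inferInstance : Dfn A fun v => ¬ ∀ x, ¬ P v x).congr fun v => by push Not; rfl

theorem Dfn.eq_var (i j : ℕ) : Dfn A fun v => v i = v j :=
  ⟨Term.equal (Term.var (Sum.inr i)) (Term.var (Sum.inr j)), fun v => by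
    rw [Formula.realize_equal]; rfl⟩

theorem Dfn.mem_var (i j : ℕ) : Dfn A fun v => v i ε v j :=
  ⟨Relations.formula₂ (L := setLang) MemRel.mem (Term.var (Sum.inr i)) (Term.var (Sum.inr j)),
    fun _ => Formula.realize_rel₂⟩

instance DfnTerm.var (i : ℕ) : DfnTerm A fun v => v i := ⟨Dfn.eq_var 0 (i + 1)⟩

theorem DfnTerm.param_of_mem {c : M} (hc : c ∈ A) : DfnTerm A fun _ => c :=
  ⟨⟨Term.equal (Term.var (Sum.inr 0)) (Term.var (Sum.inl ⟨c, hc⟩)), fun v => by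
    rw [Formula.realize_equal]; rfl⟩⟩

instance DfnTerm.param (c : M) : DfnTerm Set.univ fun _ => c := param_of_mem (Set.mem_univ c)

/-- The language has no function symbols, so a term is eliminated by an existential quantifier over
its graph. -/
theorem Dfn.subst {P : (ℕ → M) → M → Prop} (h : Dfn A fun v => P (fun n => v (n + 1)) (v 0))
    {t : (ℕ → M) → M} [ht : DfnTerm A t] : Dfn A fun v => P v (t v) := by
  have := ht.graph
  exact (inferInstance : Dfn A fun v => ∃ x, (x = t v ∧ P v x)).congr fun v => by simp

theorem Dfn.subst₁ {P : M → Prop} (h : Dfn A fun v => P (v 0))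
    {t : (ℕ → M) → M} [ht : DfnTerm A t] : Dfn A fun v => P (t v) :=
  Dfn.subst (P := fun _ x => P x) h

theorem DfnTerm.rename {t : (ℕ → M) → M} (h : DfnTerm A t) (f : ℕ → ℕ) :
    DfnTerm A fun v => t fun n => v (f n) :=
  ⟨(h.graph.rename fun n => n.casesOn 0 fun m => f m + 1)⟩

theorem Dfn.subst₂ {P : M → M → Prop} (h : Dfn A fun v => P (v 0) (v 1))
    {t s : (ℕ → M) → M} [ht : DfnTerm A t] [hs : DfnTerm A s] : Dfn A fun v => P (t v) (s v) := by
  have := ht.rename (· + 1)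
  exact Dfn.subst (P := fun v x => P (t v) x) (Dfn.subst (P := fun v x => P x (v 0))
    (h.rename fun n => n))

theorem Dfn.subst₃ {P : M → M → M → Prop} (h : Dfn A fun v => P (v 0) (v 1) (v 2))
    {t s r : (ℕ → M) → M} [ht : DfnTerm A t] [hs : DfnTerm A s] [DfnTerm A r] :
    Dfn A fun v => P (t v) (s v) (r v) := by
  have := ht.rename (· + 1)
  have := hs.rename (· + 1)
  have := (ht.rename (· + 1)).rename (· + 1)
  exact Dfn.subst (P := fun v x => P (t v) (s v) x) <|
    Dfn.subst (P := fun v x => P (t fun n => v (n + 1)) x (v 0)) <|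
      Dfn.subst (P := fun v x => P x (v 0) (v 1)) h

theorem DfnTerm.subst₁ {F : M → M} (h : DfnTerm A fun v => F (v 0))
    {t : (ℕ → M) → M} [ht : DfnTerm A t] : DfnTerm A fun v => F (t v) := by
  have := ht.rename (· + 1)
  exact ⟨Dfn.subst₂ (P := fun x y => x = F y) h.graph (t := fun v => v 0)⟩

theorem DfnTerm.subst₂ {F : M → M → M} (h : DfnTerm A fun v => F (v 0) (v 1))
    {t s : (ℕ → M) → M} [ht : DfnTerm A t] [hs : DfnTerm A s] :
    DfnTerm A fun v => F (t v) (s v) := by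
  have := ht.rename (· + 1)
  have := hs.rename (· + 1)
  exact ⟨Dfn.subst₃ (P := fun x y z => x = F y z) h.graph (t := fun v => v 0)⟩

theorem DfnTerm.subst₃ {F : M → M → M → M} (h : DfnTerm A fun v => F (v 0) (v 1) (v 2))
    {t s r : (ℕ → M) → M} [ht : DfnTerm A t] [hs : DfnTerm A s] [hr : DfnTerm A r] :
    DfnTerm A fun v => F (t v) (s v) (r v) := by
  have := (hs.rename (· + 1))
  have := (hr.rename (· + 1))
  have := (hs.rename (· + 1)).rename (· + 1)
  have := (hr.rename (· + 1)).rename (· + 1)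
  have h₁ : Dfn A fun v => v 1 = F (v 0) (s fun n => v (n + 1 + 1)) (r fun n => v (n + 1 + 1)) := by
    have := ((hr.rename (· + 1)).rename (· + 1)).rename (· + 1)
    refine Dfn.subst (P := fun v x => v 1 = F (v 0) x (r fun n => v (n + 1 + 1))) ?_
    refine Dfn.subst (P := fun v x => v 2 = F (v 1) (v 0) x) ?_
    exact h.graph.rename fun n => n.casesOn 3 fun m => m.casesOn 2 fun m => m.casesOn 1 fun _ => 0
  have := ht.rename (· + 1)
  constructor
  exact Dfn.subst (P := fun v x => v 0 = F x (s fun n => v (n + 1)) (r fun n => v (n + 1)))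
    (t := fun v => t fun n => v (n + 1)) h₁

instance Dfn.eq {t s : (ℕ → M) → M} [DfnTerm A t] [DfnTerm A s] : Dfn A fun v => t v = s v :=
  Dfn.subst₂ (Dfn.eq_var 0 1)

instance Dfn.ne {t s : (ℕ → M) → M} [DfnTerm A t] [DfnTerm A s] : Dfn A fun v => t v ≠ s v :=
  (inferInstance : Dfn A fun v => ¬ t v = s v)

instance Dfn.mem {t s : (ℕ → M) → M} [DfnTerm A t] [DfnTerm A s] : Dfn A fun v => t v ε s v :=
  Dfn.subst₂ (Dfn.mem_var 0 1)

/-- The subset relation of the structure `M`. -/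
def IsSub (x y : M) : Prop := ∀ z, z ε x → z ε y

instance {t s : (ℕ → M) → M} [DfnTerm A t] [DfnTerm A s] : Dfn A fun v => IsSub (t v) (s v) :=
  Dfn.subst₂ (by unfold IsSub; infer_instance)

theorem IsSub.refl (x : M) : IsSub x x := fun _ h => h

theorem IsSub.trans {x y z : M} (h : IsSub x y) (h' : IsSub y z) : IsSub x z :=
  fun w hw => h' w (h w hw)

end Framework

/-! ### Meaning of the basic formulas in a structure -/

section Realize

variable {M : Type u} [setLang.Structure M] {n : ℕ} (e : Empty → M) (v : Fin n → M)

@[simp] theorem realize_all' (φ : Fin (n + 1) → Fm (n + 1)) :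
    (all φ).Realize e v ↔ ∀ x, (φ (Fin.last n)).Realize e (Fin.snoc v x : Fin (n + 1) → M) :=
  BoundedFormula.realize_all

@[simp] theorem realize_ex' (φ : Fin (n + 1) → Fm (n + 1)) :
    (ex φ).Realize e v ↔ ∃ x, (φ (Fin.last n)).Realize e (Fin.snoc v x : Fin (n + 1) → M) :=
  BoundedFormula.realize_ex

@[simp] theorem realize_mem (x y : Fin n) : (mem x y).Realize e v ↔ v x ε v y :=
  BoundedFormula.realize_rel₂

@[simp] theorem realize_eq (x y : Fin n) : (eq x y).Realize e v ↔ v x = v y :=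
  BoundedFormula.realize_bdEqual _ _

@[simp] theorem realize_allIn (a : Fin n) (φ : Fin (n + 1) → Fm (n + 1)) :
    (allIn a φ).Realize e v ↔
      ∀ x, x ε v a → (φ (Fin.last n)).Realize e (Fin.snoc v x : Fin (n + 1) → M) := by
  simp [allIn]

@[simp] theorem realize_exIn (a : Fin n) (φ : Fin (n + 1) → Fm (n + 1)) :
    (exIn a φ).Realize e v ↔
      ∃ x, x ε v a ∧ (φ (Fin.last n)).Realize e (Fin.snoc v x : Fin (n + 1) → M) := by
  simp [exIn]

@[simp] theorem realize_subset (x y : Fin n) : (subset x y).Realize e v ↔ IsSub (v x) (v y) := by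
  simp [subset, IsSub]

@[simp] theorem realize_isEmpty (x : Fin n) : (isEmpty x).Realize e v ↔ ∀ z, ¬ z ε v x := by
  simp [isEmpty]

@[simp] theorem realize_isUPair (z x y : Fin n) :
    (isUPair z x y).Realize e v ↔ ∀ w, w ε v z ↔ (w = v x ∨ w = v y) := by
  simp [isUPair]

@[simp] theorem realize_isSucc (y x : Fin n) :
    (isSucc y x).Realize e v ↔ ∀ w, w ε v y ↔ (w ε v x ∨ w = v x) := by
  simp [isSucc]

theorem realize_inst {α : Type} (φ : setLang.Formula α) (g : α → Fin n) :
    (inst φ g).Realize e v ↔ φ.Realize fun i => v (g i) := by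
  unfold inst
  refine BoundedFormula.realize_relabel.trans ?_
  unfold Formula.Realize
  apply iff_of_eq; congr 1
  · funext i; exact i.elim0

end Realize

/-! ### The axioms of ZF in semantic form -/

/-- A model of ZF. -/
class ZFModel (M : Type u) [setLang.Structure M] : Prop where
  models : M ⊨ ZF

section Axioms

variable {M : Type u} [setLang.Structure M] [hM : ZFModel M]

theorem realize_of_mem_ZF {σ : setLang.Sentence} (h : σ ∈ ZF) :
    BoundedFormula.Realize (M := M) σ default default :=
  hM.models.realize_of_mem σ h

theorem ext {x y : M} (h : ∀ z, z ε x ↔ z ε y) : x = y := by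
  have := realize_of_mem_ZF (M := M) (σ := extensionality) (by simp [ZF])
  simp [extensionality] at this
  exact this x y h

theorem exists_min {x y : M} (h : y ε x) : ∃ y, y ε x ∧ ∀ z, z ε y → ¬ z ε x := by
  have := realize_of_mem_ZF (M := M) (σ := foundation) (by simp [ZF])
  simp [foundation] at this
  exact this x y h

theorem exists_upair (x y : M) : ∃ z, ∀ w, w ε z ↔ (w = x ∨ w = y) := by
  have := realize_of_mem_ZF (M := M) (σ := pairing) (by simp [ZF])
  simp [pairing] at this
  exact this x y

theorem exists_union (x : M) : ∃ u, ∀ z, z ε u ↔ ∃ y, y ε x ∧ z ε y := by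
  have := realize_of_mem_ZF (M := M) (σ := union) (by simp [ZF])
  simp [union] at this
  exact this x

theorem exists_power (x : M) : ∃ p, ∀ z, z ε p ↔ IsSub z x := by
  have := realize_of_mem_ZF (M := M) (σ := powerSet) (by simp [ZF])
  simp [powerSet] at this
  exact this x

theorem exists_inductive : ∃ w : M, (∃ z, z ε w ∧ ∀ y, ¬ y ε z) ∧
    ∀ x, x ε w → ∃ y, y ε w ∧ ∀ z, z ε y ↔ (z ε x ∨ z = x) := by
  have := realize_of_mem_ZF (M := M) (σ := infinity) (by simp [ZF])
  simp [infinity] at this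
  exact this

instance : Nonempty M := ⟨(exists_inductive (M := M)).choose⟩

/-- A formula with parameters uses only finitely many of them. -/
theorem exists_finite_params {A : Set M} (φ : setLang.Formula (A ⊕ ℕ)) {m : ℕ} (c : ℕ → Fin m) :
    ∃ (k : ℕ) (p : Fin k → M) (ψ : setLang.Formula (Fin k ⊕ Fin m)), ∀ w : Fin m → M,
      ψ.Realize (Sum.elim p w) ↔ φ.Realize (Sum.elim (fun a => a.1) fun n => w (c n)) := by
  classical
  obtain ⟨x₀⟩ := (inferInstance : Nonempty M)
  -- `g` numbers parameters and variables alike. The parameter slot of a variable is never read and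
  -- holds the dummy `x₀`.
  let g := φ.freeVarFinset.equivFin
  refine ⟨_, fun i => Sum.elim (fun a => a.1) (fun _ => x₀) (g.symm i).1,
    φ.restrictFreeVar fun s => Sum.elim (fun _ => Sum.inl (g s)) (fun n => Sum.inr (c n)) s.1,
    fun w => BoundedFormula.realize_restrictFreeVar _ ?_⟩
  rintro ⟨a | n, h⟩ <;> simp

theorem separation_of_dfn {P : M → Prop} (h : Dfn Set.univ fun v => P (v 0)) (a : M) :
    ∃ b, ∀ x, x ε b ↔ (x ε a ∧ P x) := by
  obtain ⟨φ, hφ⟩ := h.out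
  obtain ⟨k, p, ψ, hψ⟩ := exists_finite_params φ fun _ => (0 : Fin 1)
  have := realize_of_mem_ZF (M := M) (σ := separation ψ) (by
    refine Or.inl (Or.inr ⟨k, ψ, rfl⟩))
  rw [separation] at this
  have := BoundedFormula.realize_alls.1 this p
  simp only [realize_all', realize_ex', BoundedFormula.realize_iff, realize_mem, realize_inst,
    BoundedFormula.realize_inf, Fin.snoc_castSucc, Fin.snoc_last] at this
  obtain ⟨b, hb⟩ := this a
  refine ⟨b, fun x => (hb x).trans (and_congr_right fun _ => ?_)⟩
  rw [← hφ fun _ => x, ← hψ fun _ => x]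
  apply iff_of_eq; congr 1
  funext i
  rcases i with i | i
  · simp
  · fin_cases i; simp

theorem replacement_of_dfn {R : M → M → Prop} (h : Dfn Set.univ fun v => R (v 0) (v 1)) (a : M)
    (hR : ∀ x, x ε a → ∀ y z, R x y → R x z → y = z) :
    ∃ b, ∀ y, y ε b ↔ ∃ x, x ε a ∧ R x y := by
  obtain ⟨φ, hφ⟩ := h.out
  obtain ⟨k, p, ψ, hψ⟩ := exists_finite_params φ fun n => n.casesOn (0 : Fin 2) fun _ => 1
  have := realize_of_mem_ZF (M := M) (σ := replacement ψ) (Or.inr ⟨k, ψ, rfl⟩)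
  rw [replacement] at this
  have := BoundedFormula.realize_alls.1 this p
  have key : ∀ x y (w : Fin k ⊕ Fin 2 → M), (∀ i, w (Sum.inl i) = p i) → w (Sum.inr 0) = x →
      w (Sum.inr 1) = y → (ψ.Realize w ↔ R x y) := by
    intro x y w h₁ h₂ h₃
    refine Iff.trans ?_ ((hψ ![x, y]).trans (Iff.trans ?_ (hφ fun n => n.casesOn x fun _ => y))) <;>
      apply iff_of_eq <;> congr 1 <;> funext i
    · rcases i with i | i
      · simp [h₁]
      · fin_cases i <;> simp [h₂, h₃]
    · rcases i with i | i
      · rfl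
      · cases i <;> rfl
  simp only [realize_all', realize_ex', BoundedFormula.realize_iff, realize_mem, realize_inst,
    BoundedFormula.realize_inf, Fin.snoc_castSucc, Fin.snoc_last, realize_allIn, realize_exIn,
    BoundedFormula.realize_imp, realize_eq] at this
  obtain ⟨b, hb⟩ := this a fun x hx y z hyz => hR x hx y z
    ((key x y _ (by simp) (by simp) (by simp)).1 hyz.1)
    ((key x z _ (by simp) (by simp) (by simp)).1 hyz.2)
  refine ⟨b, fun y => (hb y).trans (exists_congr fun x => and_congr_right fun _ => ?_)⟩
  exact key x y _ (by simp) (by simp) (by simp)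

end Axioms

/-! ### Elementary set operations -/

section Sets

variable {M : Type u} [setLang.Structure M] [hM : ZFModel M] {A : Set M}

theorem exists_emp : ∃ x : M, ∀ z, ¬ z ε x := by
  obtain ⟨w, ⟨z, -, hz⟩, -⟩ := exists_inductive (M := M)
  exact ⟨z, hz⟩

/-- The empty set of `M`. -/
noncomputable def emp : M := exists_emp.choose

@[simp] theorem not_mem_emp (z : M) : ¬ z ε emp := exists_emp.choose_spec z

theorem eq_emp {x : M} (h : ∀ z, ¬ z ε x) : x = emp :=
  ext fun z => by simp [h z]

theorem eq_emp_iff {x : M} : x = emp ↔ ∀ z, ¬ z ε x :=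
  ⟨by rintro rfl; exact not_mem_emp, eq_emp⟩

instance DfnTerm.emp : DfnTerm A fun _ => emp :=
  ⟨(inferInstance : Dfn A fun v => ∀ z, ¬ z ε v 0).congr fun _ => eq_emp_iff.symm⟩

open Classical in
/-- The unique element with property `P`, with the empty set as junk value. -/
noncomputable def the (P : M → Prop) : M :=
  if h : ∃ x, P x ∧ ∀ y, P y → y = x then h.choose else emp

theorem the_eq {P : M → Prop} {x : M} (h : P x) (h' : ∀ y, P y → y = x) : the P = x := by
  have : ∃ x, P x ∧ ∀ y, P y → y = x := ⟨x, h, h'⟩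
  rw [the, dif_pos this]
  exact h' _ this.choose_spec.1

theorem the_spec {P : M → Prop} (h : ∃ x, P x ∧ ∀ y, P y → y = x) : P (the P) := by
  obtain ⟨x, h, h'⟩ := h
  rwa [the_eq h h']

/-- The junk value is itself definable, so no existence hypothesis is needed: an operation can be
recognised as definable before the set it describes is known to exist. -/
instance DfnTerm.the {P : (ℕ → M) → M → Prop} [h : Dfn A fun v => P (fun n => v (n + 1)) (v 0)] :
    DfnTerm A fun v => the (P v) := by
  have h₂ : Dfn A fun v => P (fun n => v (n + 2)) (v 0) :=
    h.rename fun n => n.casesOn 0 fun m => m + 2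
  have h₃ : Dfn A fun v => P (fun n => v (n + 3)) (v 0) :=
    h.rename fun n => n.casesOn 0 fun m => m + 3
  have h₄ : Dfn A fun v => P (fun n => v (n + 2)) (v 0) ∧
      ∀ y, P (fun n => v (n + 2)) y → y = v 0 := inferInstance
  constructor
  have : Dfn A fun v => ∃ x, P (fun n => v (n + 1)) x ∧
      ∀ y, P (fun n => v (n + 1)) y → y = x := Dfn.ex (h := h₄)
  refine (inferInstance : Dfn A fun v =>
    (P (fun n => v (n + 1)) (v 0) ∧ ∀ y, P (fun n => v (n + 1)) y → y = v 0) ∨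
    (¬ (∃ x, P (fun n => v (n + 1)) x ∧ ∀ y, P (fun n => v (n + 1)) y → y = x) ∧
      v 0 = SetModel.emp)).congr fun v => ⟨?_, ?_⟩
  · rintro (⟨h, h'⟩ | ⟨h, h'⟩)
    · exact (the_eq h h').symm
    · rw [SetModel.the, dif_neg h, h']
  · intro e
    by_cases h : ∃ x, P (fun n => v (n + 1)) x ∧ ∀ y, P (fun n => v (n + 1)) y → y = x
    · left
      obtain ⟨x, h, h'⟩ := h
      rw [the_eq h h'] at e
      rw [e]; exact ⟨h, h'⟩
    · exact Or.inr ⟨h, by rw [e, SetModel.the, dif_neg h]⟩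

/-- The set of all `x` with property `P`, with the empty set as junk value. -/
noncomputable def cls (P : M → Prop) : M := the fun b => ∀ x, x ε b ↔ P x

instance DfnTerm.cls {P : (ℕ → M) → M → Prop} [h : Dfn A fun v => P (fun n => v (n + 1)) (v 0)] :
    DfnTerm A fun v => cls (P v) :=
  have : Dfn A fun v => P (fun n => v (n + 2)) (v 0) :=
    h.rename fun n => n.casesOn 0 fun m => m + 2
  DfnTerm.the

theorem mem_cls_of_exists {P : M → Prop} (h : ∃ b, ∀ x, x ε b ↔ P x) (x : M) :
    x ε cls P ↔ P x := by
  obtain ⟨b, hb⟩ := h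
  exact the_spec (P := fun b => ∀ x, x ε b ↔ P x)
    ⟨b, hb, fun y hy => ext fun z => (hy z).trans (hb z).symm⟩ x

theorem mem_cls {P : M → Prop} [h : Dfn Set.univ fun v => P (v 0)] (a : M)
    (ha : ∀ x, P x → x ε a) (x : M) : x ε cls P ↔ P x := by
  obtain ⟨b, hb⟩ := separation_of_dfn h a
  exact mem_cls_of_exists ⟨b, fun x => (hb x).trans ⟨fun h => h.2, fun h => ⟨ha x h, h⟩⟩⟩ x

/-- The unordered pair. -/
noncomputable def upair (x y : M) : M := cls fun w => w = x ∨ w = y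

@[simp] theorem mem_upair {x y w : M} : w ε upair x y ↔ w = x ∨ w = y :=
  mem_cls_of_exists (exists_upair x y) w

instance {t s : (ℕ → M) → M} [DfnTerm A t] [DfnTerm A s] : DfnTerm A fun v => upair (t v) (s v) :=
  DfnTerm.subst₂ (by unfold upair; infer_instance)

/-- The ordered pair. -/
noncomputable def pair (x y : M) : M := upair (upair x x) (upair x y)

instance {t s : (ℕ → M) → M} [DfnTerm A t] [DfnTerm A s] : DfnTerm A fun v => pair (t v) (s v) :=
  DfnTerm.subst₂ (by unfold pair; infer_instance)

theorem upair_inj {x y x' y' : M} (h : upair x y = upair x' y') :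
    (x = x' ∧ y = y') ∨ (x = y' ∧ y = x') := by
  have h₁ : x ε upair x' y' := by rw [← h]; simp
  have h₂ : y ε upair x' y' := by rw [← h]; simp
  have h₃ : x' ε upair x y := by rw [h]; simp
  have h₄ : y' ε upair x y := by rw [h]; simp
  rw [mem_upair] at *
  grind

theorem pair_inj' {x y x' y' : M} (h : pair x y = pair x' y') : x = x' ∧ y = y' := by
  rcases upair_inj h with ⟨h₁, h₂⟩ | ⟨h₁, h₂⟩ <;>
    rcases upair_inj h₁ with h₁ | h₁ <;> rcases upair_inj h₂ with h₂ | h₂ <;> grind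

@[simp] theorem pair_inj {x y x' y' : M} : pair x y = pair x' y' ↔ x = x' ∧ y = y' :=
  ⟨pair_inj', by rintro ⟨rfl, rfl⟩; rfl⟩

theorem pair_ne_emp {x y : M} : pair x y ≠ emp := by
  intro h
  have : upair x x ε pair x y := by simp [pair]
  rw [h] at this
  simp at this

/-- The union of a set. -/
noncomputable def sUn (x : M) : M := cls fun z => ∃ y, y ε x ∧ z ε y

@[simp] theorem mem_sUn {x z : M} : z ε sUn x ↔ ∃ y, y ε x ∧ z ε y :=
  mem_cls_of_exists (exists_union x) z

instance {t : (ℕ → M) → M} [DfnTerm A t] : DfnTerm A fun v => sUn (t v) :=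
  DfnTerm.subst₁ (by unfold sUn; infer_instance)

/-- The power set. -/
noncomputable def pow (x : M) : M := cls fun z => IsSub z x

@[simp] theorem mem_pow {x z : M} : z ε pow x ↔ IsSub z x :=
  mem_cls_of_exists (exists_power x) z

instance {t : (ℕ → M) → M} [DfnTerm A t] : DfnTerm A fun v => pow (t v) :=
  DfnTerm.subst₁ (by unfold pow; infer_instance)

/-- The union of two sets. -/
noncomputable def cup (x y : M) : M := cls fun z => z ε x ∨ z ε y

@[simp] theorem mem_cup {x y z : M} : z ε cup x y ↔ z ε x ∨ z ε y :=
  mem_cls (sUn (upair x y)) (by simp) z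

instance {t s : (ℕ → M) → M} [DfnTerm A t] [DfnTerm A s] : DfnTerm A fun v => cup (t v) (s v) :=
  DfnTerm.subst₂ (by unfold cup; infer_instance)

/-- The successor `x ∪ {x}`. -/
noncomputable def succ (x : M) : M := cls fun z => z ε x ∨ z = x

@[simp] theorem mem_succ {x z : M} : z ε succ x ↔ z ε x ∨ z = x :=
  mem_cls (cup x (upair x x)) (by simp) z

instance {t : (ℕ → M) → M} [DfnTerm A t] : DfnTerm A fun v => succ (t v) :=
  DfnTerm.subst₁ (by unfold succ; infer_instance)

/-- The image of a set under a function. -/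
noncomputable def image (F : M → M) (a : M) : M := cls fun y => ∃ x, x ε a ∧ y = F x

@[simp] theorem mem_image {F : M → M} [h : DfnTerm Set.univ fun v => F (v 0)] {a y : M} :
    y ε image F a ↔ ∃ x, x ε a ∧ y = F x := by
  exact mem_cls_of_exists (replacement_of_dfn (R := fun x y => y = F x)
    (have := h.rename fun _ => 0; inferInstance) a (by rintro x - y z rfl rfl; rfl)) y

theorem not_mem_self (x : M) : ¬ x ε x := by
  intro h
  obtain ⟨y, hy, hy'⟩ := exists_min (x := upair x x) (y := x) (by simp)
  simp at hy
  subst hy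
  exact hy' y h (by simp)

theorem mem_asymm {x y : M} (h : x ε y) : ¬ y ε x := by
  intro h'
  obtain ⟨z, hz, hz'⟩ := exists_min (x := upair x y) (y := x) (by simp)
  rcases mem_upair.1 hz with rfl | rfl
  · exact hz' y h' (by simp)
  · exact hz' x h (by simp)

end Sets

/-! ### Ordinals, least ordinals and bounds -/

section Ordinals

variable {M : Type u} [setLang.Structure M] {A : Set M}

/-- Transitive sets. -/
def IsTr (x : M) : Prop := ∀ y, y ε x → IsSub y x

instance {t : (ℕ → M) → M} [DfnTerm A t] : Dfn A fun v => IsTr (t v) :=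
  Dfn.subst₁ (by unfold IsTr; infer_instance)

/-- Ordinals: transitive sets of transitive sets. -/
def IsOrd (x : M) : Prop := IsTr x ∧ ∀ y, y ε x → IsTr y

instance {t : (ℕ → M) → M} [DfnTerm A t] : Dfn A fun v => IsOrd (t v) :=
  Dfn.subst₁ (by unfold IsOrd; infer_instance)

theorem IsOrd.mem {α β : M} (h : IsOrd α) (h' : β ε α) : IsOrd β :=
  ⟨h.2 β h', fun y hy => h.2 y (h.1 β h' y hy)⟩

variable [hM : ZFModel M]

theorem IsOrd.exists_least {P : M → Prop} [Dfn Set.univ fun v => P (v 0)] {α : M} (h : IsOrd α)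
    (hP : P α) : ∃ β, (IsOrd β ∧ P β) ∧ ∀ γ, γ ε β → ¬ P γ := by
  by_cases hα : ∀ γ, γ ε α → ¬ P γ
  · exact ⟨α, ⟨h, hP⟩, hα⟩
  · push Not at hα
    obtain ⟨γ, hγ, hγ'⟩ := hα
    have key : ∀ x, x ε cls (fun x => x ε α ∧ P x) ↔ x ε α ∧ P x := mem_cls α fun x h => h.1
    obtain ⟨β, hβ, hβ'⟩ := exists_min ((key γ).2 ⟨hγ, hγ'⟩)
    obtain ⟨h₁, h₂⟩ := (key β).1 hβ
    exact ⟨β, ⟨h.mem h₁, h₂⟩, fun δ hδ hδ' => hβ' δ hδ ((key δ).2 ⟨h.1 β h₁ δ hδ, hδ'⟩)⟩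

theorem IsOrd.induction {P : M → Prop} [Dfn Set.univ fun v => P (v 0)]
    (h : ∀ α, IsOrd α → (∀ β, β ε α → P β) → P α) {α : M} (hα : IsOrd α) : P α := by
  by_contra hP
  obtain ⟨β, ⟨h₁, h₂⟩, h₃⟩ := hα.exists_least (P := fun x => ¬ P x) hP
  exact h₂ (h β h₁ fun γ hγ => not_not.1 (h₃ γ hγ))

theorem IsOrd.trichotomy {α β : M} (hα : IsOrd α) (hβ : IsOrd β) : α ε β ∨ α = β ∨ β ε α := by
  revert β
  suffices ∀ β, IsOrd β → α ε β ∨ α = β ∨ β ε α from fun {β} h => this β h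
  refine IsOrd.induction (P := fun α => ∀ β, IsOrd β → α ε β ∨ α = β ∨ β ε α) ?_ hα
  intro α hα ih β hβ
  refine IsOrd.induction (P := fun β => α ε β ∨ α = β ∨ β ε α) ?_ hβ
  intro β hβ ih'
  by_contra hn
  push Not at hn
  refine hn.2.1 (ext fun x => ⟨fun hx => ?_, fun hx => ?_⟩)
  · rcases ih x hx β hβ with h | rfl | h
    · exact h
    · exact absurd hx hn.2.2
    · exact absurd (hα.1 x hx β h) hn.2.2
  · rcases ih' x hx with h | rfl | h
    · exact absurd (hβ.1 x hx α h) hn.1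
    · exact absurd hx hn.1
    · exact h

theorem IsOrd.sub_or_mem {α β : M} (hα : IsOrd α) (hβ : IsOrd β) : IsSub α β ∨ β ε α := by
  rcases hα.trichotomy hβ with h | rfl | h
  · exact Or.inl (hβ.1 α h)
  · exact Or.inl (IsSub.refl α)
  · exact Or.inr h

theorem IsOrd.mem_of_sub_of_mem {α β γ : M} (hα : IsOrd α) (hγ : IsOrd γ) (h : IsSub α β)
    (h' : β ε γ) : α ε γ := by
  rcases hα.trichotomy hγ with h₁ | rfl | h₁
  · exact h₁
  · exact absurd (h β h') (not_mem_self β)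
  · exact absurd (h γ h₁) (mem_asymm h')

theorem isOrd_emp : IsOrd (emp : M) := ⟨fun y hy => by simp at hy, fun y hy => by simp at hy⟩

theorem IsOrd.succ {α : M} (h : IsOrd α) : IsOrd (succ α) := by
  refine ⟨fun y hy z hz => ?_, fun y hy => ?_⟩
  · rw [mem_succ] at *
    rcases hy with hy | rfl
    · exact Or.inl (h.1 y hy z hz)
    · exact Or.inl hz
  · rcases mem_succ.1 hy with hy | rfl
    · exact h.2 y hy
    · exact h.1

theorem isOrd_sUn {x : M} (h : ∀ y, y ε x → IsOrd y) : IsOrd (sUn x) := by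
  refine ⟨fun y hy z hz => ?_, fun y hy => ?_⟩
  · obtain ⟨w, hw, hw'⟩ := mem_sUn.1 hy
    exact mem_sUn.2 ⟨w, hw, (h w hw).1 y hw' z hz⟩
  · obtain ⟨w, hw, hw'⟩ := mem_sUn.1 hy
    exact (h w hw).2 y hw'

theorem isSub_sUn {x y : M} (h : y ε x) : IsSub y (sUn x) := fun _ hz => mem_sUn.2 ⟨y, h, hz⟩

/-- The ordinals that belong to a given set are bounded. -/
theorem exists_ord_bound (x : M) : ∃ α, IsOrd α ∧ ∀ β, IsOrd β → β ε x → β ε α := by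
  have key : ∀ y, y ε cls (fun y => y ε x ∧ IsOrd y) ↔ y ε x ∧ IsOrd y := mem_cls x fun x h => h.1
  refine ⟨succ (sUn (cls fun y => y ε x ∧ IsOrd y)),
    (isOrd_sUn fun y hy => ((key y).1 hy).2).succ, fun β hβ hx => ?_⟩
  have := isSub_sUn ((key β).2 ⟨hx, hβ⟩)
  have h' := isOrd_sUn fun y hy => ((key y).1 hy).2
  exact hβ.mem_of_sub_of_mem h'.succ this (mem_succ.2 (Or.inr rfl))

/-- The least ordinal with property `P`. -/
noncomputable def leastOrd (P : M → Prop) : M :=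
  the fun α => (IsOrd α ∧ P α) ∧ ∀ β, β ε α → ¬ P β

instance DfnTerm.leastOrd {P : (ℕ → M) → M → Prop}
    [h : Dfn A fun v => P (fun n => v (n + 1)) (v 0)] : DfnTerm A fun v => leastOrd (P v) :=
  have : Dfn A fun v => P (fun n => v (n + 2)) (v 0) :=
    h.rename fun n => n.casesOn 0 fun m => m + 2
  DfnTerm.the

theorem leastOrd_spec {P : M → Prop} [Dfn Set.univ fun v => P (v 0)] {α : M} (h : IsOrd α)
    (hP : P α) : (IsOrd (leastOrd P) ∧ P (leastOrd P)) ∧ IsSub (leastOrd P) α := by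
  obtain ⟨β, h₁, h₂⟩ := h.exists_least hP
  have e : leastOrd P = β := the_eq ⟨h₁, h₂⟩ fun y ⟨h₃, h₄⟩ => by
    rcases h₃.1.trichotomy h₁.1 with h | h | h
    · exact absurd h₃.2 (h₂ _ h)
    · exact h
    · exact absurd h₁.2 (h₄ _ h)
  rw [e]
  refine ⟨h₁, (h₁.1.sub_or_mem h).resolve_right fun h => h₂ _ h hP⟩

/-- Every ordinal-valued definable function on a set is bounded. -/
theorem exists_ord_bound_image (F : M → M) [DfnTerm Set.univ fun v => F (v 0)] (a : M) :
    ∃ α, IsOrd α ∧ ∀ x, x ε a → IsOrd (F x) → F x ε α := by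
  obtain ⟨α, h, h'⟩ := exists_ord_bound (image F a)
  exact ⟨α, h, fun x hx hF => h' _ hF (mem_image.2 ⟨x, hx, rfl⟩)⟩

/-- Collection with ordinal bounds. -/
theorem exists_ord_bound_of_forall (R : M → M → Prop)
    [h : Dfn Set.univ fun v => R (v 1) (v 0)] (a : M)
    (hR : ∀ x, x ε a → ∃ α, IsOrd α ∧ R x α)
    (mono : ∀ x α β, IsOrd α → IsOrd β → IsSub α β → R x α → R x β) :
    ∃ α, IsOrd α ∧ ∀ x, x ε a → R x α := by
  have : DfnTerm Set.univ fun v => SetModel.leastOrd (R (v 0)) :=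
    DfnTerm.leastOrd (P := fun v x => R (v 0) x)
  -- The least witnesses form a definable function, bounded by replacement; monotonicity then
  -- carries `R` up to the bound.
  obtain ⟨α, hα, h'⟩ := exists_ord_bound_image (fun x => SetModel.leastOrd (R x)) a
  refine ⟨α, hα, fun x hx => ?_⟩
  have : Dfn Set.univ fun v => R x (v 0) :=
    Dfn.subst (P := fun v y => R y (v 0)) (t := fun _ => x) (h.rename fun n => n.casesOn 1 fun _ => 0)
  obtain ⟨β, hβ, hβ'⟩ := hR x hx
  obtain ⟨⟨h₁, h₂⟩, -⟩ := leastOrd_spec hβ hβ'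
  exact mono x _ α h₁ hα (hα.1 _ (h' x hx h₁)) h₂

end Ordinals

/-! ### Recursion on the ordinals -/

section Recursion

variable {M : Type u} [setLang.Structure M] [hM : ZFModel M] {A : Set M}

/-- The value of the function `h` at `x`. -/
noncomputable def ap (h x : M) : M := the fun y => pair x y ε h

instance {t s : (ℕ → M) → M} [DfnTerm A t] [DfnTerm A s] : DfnTerm A fun v => ap (t v) (s v) :=
  DfnTerm.subst₂ (by unfold ap; infer_instance)

/-- The restriction of the function `h` to `d`. -/
noncomputable def restr (h d : M) : M := cls fun z => z ε h ∧ ∃ x, x ε d ∧ ∃ y, z = pair x y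

instance {t s : (ℕ → M) → M} [DfnTerm A t] [DfnTerm A s] : DfnTerm A fun v => restr (t v) (s v) :=
  DfnTerm.subst₂ (by unfold restr; infer_instance)

theorem mem_restr {h d z : M} : z ε restr h d ↔ z ε h ∧ ∃ x, x ε d ∧ ∃ y, z = pair x y :=
  mem_cls h (fun _ h => h.1) z

/-- `h` is the function on `α` obtained by recursion with the step function `G`. -/
def IsHist (G : M → M) (h α : M) : Prop :=
  ∀ z, z ε h ↔ ∃ β, β ε α ∧ z = pair β (G (restr h β))

/-- The function on `α` obtained by recursion with the step function `G`. -/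
noncomputable def hist (G : M → M) (α : M) : M := the fun h => IsHist G h α

/-- The value at `α` of the function on the ordinals defined by recursion with the step function
`G`. -/
noncomputable def ordRec (G : M → M) (α : M) : M := G (hist G α)

theorem DfnTerm.hist {G : M → M} (hG : DfnTerm A fun v => G (v 0)) {t : (ℕ → M) → M}
    [DfnTerm A t] : DfnTerm A fun v => hist G (t v) := by
  have : ∀ t : (ℕ → M) → M, [DfnTerm A t] → DfnTerm A fun v => G (t v) := fun t _ => hG.subst₁
  exact DfnTerm.subst₁ (by unfold SetModel.hist IsHist; infer_instance)

instance DfnTerm.ordRec {G : M → M} [hG : DfnTerm A fun v => G (v 0)] {t : (ℕ → M) → M}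
    [DfnTerm A t] : DfnTerm A fun v => ordRec G (t v) :=
  have := hG.hist (t := t)
  hG.subst₁

theorem IsHist.mem_restr {G : M → M} {h α β : M} (H : IsHist G h α) (hα : IsOrd α) (hβ : β ε α)
    {z : M} : z ε restr h β ↔ ∃ γ, γ ε β ∧ z = pair γ (G (restr h γ)) := by
  rw [SetModel.mem_restr, H]
  constructor
  · rintro ⟨⟨γ, hγ, rfl⟩, δ, hδ, y, e⟩
    obtain ⟨rfl, rfl⟩ := pair_inj.1 e
    exact ⟨γ, hδ, rfl⟩
  · rintro ⟨γ, hγ, rfl⟩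
    exact ⟨⟨γ, hα.1 β hβ γ hγ, rfl⟩, γ, hγ, _, rfl⟩

theorem restr_restr {h α β : M} (h' : IsSub β α) : restr (restr h α) β = restr h β := by
  apply ext
  intro z
  simp only [mem_restr]
  constructor
  · rintro ⟨⟨h₁, -⟩, h₂⟩
    exact ⟨h₁, h₂⟩
  · rintro ⟨h₁, x, hx, h₂⟩
    exact ⟨⟨h₁, x, h' x hx, h₂⟩, x, hx, h₂⟩

theorem IsHist.isHist_restr {G : M → M} {h α β : M} (H : IsHist G h α) (hα : IsOrd α) (hβ : β ε α) :
    IsHist G (restr h β) β := by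
  intro z
  rw [H.mem_restr hα hβ]
  refine exists_congr fun γ => and_congr_right fun hγ => ?_
  rw [restr_restr ((hα.mem hβ).1 γ hγ)]

theorem IsHist.unique {G : M → M} [DfnTerm Set.univ fun v => G (v 0)] {h h' α : M}
    (hα : IsOrd α) (H : IsHist G h α) (H' : IsHist G h' α) : h = h' := by
  have : ∀ β, β ε α → restr h β = restr h' β := by
    intro β hβ
    refine IsOrd.induction (P := fun β => β ε α → restr h β = restr h' β) ?_ (hα.mem hβ) hβ
    intro β _ ih hβ
    apply ext
    intro z
    rw [H.mem_restr hα hβ, H'.mem_restr hα hβ]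
    refine exists_congr fun γ => and_congr_right fun hγ => ?_
    rw [ih γ hγ (hα.1 β hβ γ hγ)]
  apply ext
  intro z
  rw [H, H']
  refine exists_congr fun γ => and_congr_right fun hγ => ?_
  rw [this γ hγ]

theorem isHist_hist (G : M → M) [hG : DfnTerm Set.univ fun v => G (v 0)] {α : M}
    (hα : IsOrd α) : IsHist G (hist G α) α := by
  have hG₁ : ∀ t : (ℕ → M) → M, [DfnTerm Set.univ t] → DfnTerm Set.univ fun v => G (t v) :=
    fun t _ => hG.subst₁
  have hG₂ : ∀ t : (ℕ → M) → M, [DfnTerm Set.univ t] → DfnTerm Set.univ fun v => hist G (t v) :=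
    fun t _ => hG.hist
  have : ∀ t s : (ℕ → M) → M, [DfnTerm Set.univ t] → [DfnTerm Set.univ s] →
      Dfn Set.univ fun v => IsHist G (t v) (s v) := fun t s _ _ =>
    Dfn.subst₂ (by unfold IsHist; infer_instance)
  refine IsOrd.induction (P := fun α => IsHist G (hist G α) α) ?_ hα
  intro α hα ih
  -- By replacement the shorter histories supply the values from which the history on `α` is
  -- assembled.
  let k := image (fun β => pair β (G (hist G β))) α
  have hk : ∀ z, z ε k ↔ ∃ β, β ε α ∧ z = pair β (G (hist G β)) := fun z => mem_image
  have hr : ∀ β, β ε α → restr k β = hist G β := by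
    intro β hβ
    apply ext
    intro z
    rw [mem_restr, ih β hβ, hk]
    constructor
    · rintro ⟨⟨γ, hγ, rfl⟩, δ, hδ, y, e⟩
      obtain ⟨rfl, rfl⟩ := pair_inj.1 e
      refine ⟨γ, hδ, ?_⟩
      rw [IsHist.unique (hα.mem hγ) (ih γ hγ) ((ih β hβ).isHist_restr (hα.mem hβ) hδ)]
    · rintro ⟨γ, hγ, rfl⟩
      have hγ' := hα.1 β hβ γ hγ
      refine ⟨⟨γ, hγ', ?_⟩, γ, hγ, _, rfl⟩
      rw [IsHist.unique (hα.mem hγ') (ih γ hγ') ((ih β hβ).isHist_restr (hα.mem hβ) hγ)]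
  have H : IsHist G k α := by
    intro z
    rw [hk]
    refine exists_congr fun γ => and_congr_right fun hγ => ?_
    rw [hr γ hγ]
  exact the_spec (P := fun h => IsHist G h α) ⟨k, H, fun y hy => hy.unique hα H⟩

theorem mem_hist {G : M → M} [hG : DfnTerm Set.univ fun v => G (v 0)] {α : M}
    (hα : IsOrd α) {z : M} : z ε hist G α ↔ ∃ β, β ε α ∧ z = pair β (ordRec G β) := by
  rw [isHist_hist G hα]
  refine exists_congr fun γ => and_congr_right fun hγ => ?_
  rw [ordRec, IsHist.unique (hα.mem hγ) (isHist_hist G (hα.mem hγ))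
    ((isHist_hist G hα).isHist_restr hα hγ)]

theorem ap_eq {h x y : M} (H : ∀ y', pair x y' ε h ↔ y' = y) : ap h x = y :=
  the_eq ((H y).2 rfl) fun y' h' => (H y').1 h'

theorem pair_mem_hist {G : M → M} [hG : DfnTerm Set.univ fun v => G (v 0)] {α x y : M}
    (hα : IsOrd α) : pair x y ε hist G α ↔ x ε α ∧ y = ordRec G x := by
  rw [mem_hist hα]
  constructor
  · rintro ⟨β, hβ, e⟩
    obtain ⟨rfl, rfl⟩ := pair_inj.1 e
    exact ⟨hβ, rfl⟩
  · rintro ⟨h, rfl⟩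
    exact ⟨x, h, rfl⟩

theorem ap_hist {G : M → M} [hG : DfnTerm Set.univ fun v => G (v 0)] {α β : M}
    (hα : IsOrd α) (hβ : β ε α) : ap (hist G α) β = ordRec G β :=
  ap_eq fun y => by rw [pair_mem_hist hα]; simp [hβ]

end Recursion

/-! ### Natural numbers of the model and standard numerals -/

section Omega

variable {M : Type u} [setLang.Structure M] [hM : ZFModel M] {A : Set M}

/-- `x` is empty or a successor. -/
def ZeroOrSucc (x : M) : Prop := x = emp ∨ ∃ y, x = succ y

instance {t : (ℕ → M) → M} [DfnTerm A t] : Dfn A fun v => ZeroOrSucc (t v) :=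
  Dfn.subst₁ (by unfold ZeroOrSucc; infer_instance)

/-- The natural numbers of `M`. -/
def IsNat (x : M) : Prop := IsOrd x ∧ ZeroOrSucc x ∧ ∀ y, y ε x → ZeroOrSucc y

instance {t : (ℕ → M) → M} [DfnTerm A t] : Dfn A fun v => IsNat (t v) :=
  Dfn.subst₁ (by unfold IsNat; infer_instance)

theorem IsNat.mem {x y : M} (h : IsNat x) (hy : y ε x) : IsNat y :=
  ⟨h.1.mem hy, h.2.2 y hy, fun z hz => h.2.2 z (h.1.1 y hy z hz)⟩

theorem isNat_emp : IsNat (emp : M) := ⟨isOrd_emp, Or.inl rfl, fun y hy => by simp at hy⟩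

theorem IsNat.succ {x : M} (h : IsNat x) : IsNat (succ x) := by
  refine ⟨h.1.succ, Or.inr ⟨x, rfl⟩, fun y hy => ?_⟩
  rcases mem_succ.1 hy with hy | rfl
  · exact h.2.2 y hy
  · exact h.2.1

/-- The set of natural numbers of `M`. -/
noncomputable def om : M := cls IsNat

instance : DfnTerm A fun _ => om := by unfold om; infer_instance

@[simp] theorem mem_om {x : M} : x ε om ↔ IsNat x := by
  obtain ⟨w, ⟨z, hz, hz'⟩, hw⟩ := exists_inductive (M := M)
  -- Any inductive set `w` bounds the class of natural numbers, by induction on them as ordinals.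
  refine mem_cls (P := IsNat) w (fun x hx => ?_) x
  refine IsOrd.induction (P := fun x => IsNat x → x ε w) ?_ hx.1 hx
  intro x _ ih hx
  rcases hx.2.1 with rfl | ⟨y, rfl⟩
  · rwa [← eq_emp hz']
  · have hy : y ε succ y := mem_succ.2 (Or.inr rfl)
    obtain ⟨y', h₁, h₂⟩ := hw y (ih y hy (hx.mem hy))
    rwa [ext (x := succ y) (y := y') fun z => by rw [h₂, mem_succ] ]

theorem isOrd_om : IsOrd (om : M) :=
  ⟨fun _ hy _ hz => mem_om.2 ((mem_om.1 hy).mem hz), fun _ hy => (mem_om.1 hy).1.1⟩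

/-- The numeral of `M` with value `k`. -/
noncomputable def num : ℕ → M
  | 0 => emp
  | k + 1 => succ (num k)

instance (k : ℕ) : DfnTerm A fun _ => num k := by
  induction k with
  | zero => exact DfnTerm.emp
  | succ k ih => unfold num; infer_instance

theorem isNat_num (k : ℕ) : IsNat (num k : M) := by
  induction k with
  | zero => exact isNat_emp
  | succ k ih => exact ih.succ

theorem num_mem_of_lt {i j : ℕ} (h : i < j) : (num i : M) ε num j := by
  induction h with
  | refl => exact mem_succ.2 (Or.inr rfl)
  | step _ ih => exact mem_succ.2 (Or.inl ih)

theorem num_injective : Function.Injective (num : ℕ → M) := by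
  intro i j h
  by_contra hn
  rcases Nat.lt_or_gt_of_ne hn with h' | h'
  · have := num_mem_of_lt (M := M) h'
    rw [h] at this
    exact not_mem_self _ this
  · have := num_mem_of_lt (M := M) h'
    rw [h] at this
    exact not_mem_self _ this

end Omega

/-! ### The cumulative hierarchy -/

section Hierarchy

variable {M : Type u} [setLang.Structure M] [hM : ZFModel M] {A : Set M}

/-- The step function of the cumulative hierarchy. -/
noncomputable def hierStep (h : M) : M := cls fun x => ∃ γ y, pair γ y ε h ∧ IsSub x y

instance {t : (ℕ → M) → M} [DfnTerm A t] : DfnTerm A fun v => hierStep (t v) :=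
  DfnTerm.subst₁ (by unfold hierStep; infer_instance)

/-- The levels of the cumulative hierarchy. -/
noncomputable def V (α : M) : M := ordRec hierStep α

instance {t : (ℕ → M) → M} [DfnTerm A t] : DfnTerm A fun v => V (t v) :=
  DfnTerm.subst₁ (by unfold V; infer_instance)

theorem mem_V {α x : M} (hα : IsOrd α) : x ε V α ↔ ∃ β, β ε α ∧ IsSub x (V β) := by
  have key : ∀ x, (∃ γ y, pair γ y ε hist hierStep α ∧ IsSub x y) ↔
      ∃ β, β ε α ∧ IsSub x (V β) := by
    intro x
    simp only [pair_mem_hist hα]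
    constructor
    · rintro ⟨γ, y, ⟨h₁, rfl⟩, h₂⟩
      exact ⟨γ, h₁, h₂⟩
    · rintro ⟨γ, h₁, h₂⟩
      exact ⟨γ, _, ⟨h₁, rfl⟩, h₂⟩
  rw [← key]
  refine mem_cls (P := fun x => ∃ γ y, pair γ y ε hist hierStep α ∧ IsSub x y)
    (sUn (image (fun β => pow (V β)) α)) ?_ x
  intro x hx
  obtain ⟨β, h₁, h₂⟩ := (key x).1 hx
  exact mem_sUn.2 ⟨_, mem_image.2 ⟨β, h₁, rfl⟩, mem_pow.2 h₂⟩

theorem V_mono {α β : M} (hα : IsOrd α) (hβ : IsOrd β) (h : IsSub α β) : IsSub (V α) (V β) := by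
  intro x hx
  obtain ⟨γ, h₁, h₂⟩ := (mem_V hα).1 hx
  exact (mem_V hβ).2 ⟨γ, h γ h₁, h₂⟩

theorem isTr_V {α : M} (hα : IsOrd α) : IsTr (V α) := by
  intro x hx y hy
  obtain ⟨γ, h₁, h₂⟩ := (mem_V hα).1 hx
  exact V_mono (hα.mem h₁) hα (hα.1 γ h₁) y (h₂ y hy)

theorem mem_V_succ {α x : M} (hα : IsOrd α) : x ε V (succ α) ↔ IsSub x (V α) := by
  rw [mem_V hα.succ]
  constructor
  · rintro ⟨β, h₁, h₂⟩
    rcases mem_succ.1 h₁ with h₁ | rfl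
    · exact h₂.trans (V_mono (hα.mem h₁) hα (hα.1 β h₁))
    · exact h₂
  · intro h
    exact ⟨α, mem_succ.2 (Or.inr rfl), h⟩

theorem isSub_V {α : M} (hα : IsOrd α) : IsSub α (V α) := by
  refine IsOrd.induction (P := fun α => IsSub α (V α)) ?_ hα
  intro α hα ih β hβ
  exact (mem_V hα).2 ⟨β, hβ, ih β hβ⟩

/-- Every set is an element of a transitive set. -/
theorem exists_isTr (x : M) : ∃ t, IsTr t ∧ x ε t := by
  -- The value at `α` consists of `x` and the elements of elements of earlier values, so going from
  -- `n` to `succ n` adds one layer and the value at `om` is transitive.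
  let G : M → M := fun h => cls fun z => z = x ∨ ∃ γ y w, pair γ y ε h ∧ w ε y ∧ z ε w
  let f : M → M := ordRec G
  have hf : ∀ α, IsOrd α → ∀ z, z ε f α ↔ z = x ∨ ∃ β, β ε α ∧ ∃ w, w ε f β ∧ z ε w := by
    intro α hα z
    have key : ∀ z, (z = x ∨ ∃ γ y w, pair γ y ε hist G α ∧ w ε y ∧ z ε w) ↔
        (z = x ∨ ∃ β, β ε α ∧ ∃ w, w ε f β ∧ z ε w) := by
      intro z
      refine or_congr_right ?_
      simp only [pair_mem_hist hα]
      constructor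
      · rintro ⟨γ, y, w, ⟨h₁, rfl⟩, h₂, h₃⟩
        exact ⟨γ, h₁, w, h₂, h₃⟩
      · rintro ⟨γ, h₁, w, h₂, h₃⟩
        exact ⟨γ, _, w, ⟨h₁, rfl⟩, h₂, h₃⟩
    rw [← key]
    refine mem_cls (P := fun z => z = x ∨ ∃ γ y w, pair γ y ε hist G α ∧ w ε y ∧ z ε w)
      (cup (upair x x) (sUn (image (fun β => sUn (f β)) α))) ?_ z
    intro z hz
    rcases (key z).1 hz with rfl | ⟨β, h₁, w, h₂, h₃⟩
    · simp
    · exact mem_cup.2 (Or.inr (mem_sUn.2 ⟨_, mem_image.2 ⟨β, h₁, rfl⟩, mem_sUn.2 ⟨w, h₂, h₃⟩⟩))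
  refine ⟨f om, fun y hy z hz => ?_, (hf om isOrd_om x).2 (Or.inl rfl)⟩
  refine (hf om isOrd_om z).2 (Or.inr ?_)
  rcases (hf om isOrd_om y).1 hy with rfl | ⟨n, hn, w, hw, hw'⟩
  · exact ⟨emp, mem_om.2 isNat_emp, y, (hf emp isOrd_emp y).2 (Or.inl rfl), hz⟩
  · have hn' := (mem_om.1 hn).succ
    exact ⟨succ n, mem_om.2 hn', y,
      (hf _ hn'.1 y).2 (Or.inr ⟨n, mem_succ.2 (Or.inr rfl), w, hw, hw'⟩), hz⟩

/-- Every set belongs to the cumulative hierarchy. -/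
theorem exists_mem_V (x : M) : ∃ α, IsOrd α ∧ x ε V α := by
  obtain ⟨t, ht, hx⟩ := exists_isTr x
  by_contra hn
  have key : ∀ y, y ε cls (fun y => y ε t ∧ ¬ ∃ α, IsOrd α ∧ y ε V α) ↔
    y ε t ∧ ¬ ∃ α, IsOrd α ∧ y ε V α := mem_cls t fun y h => h.1
  obtain ⟨y, hy, hy'⟩ := exists_min ((key x).2 ⟨hx, hn⟩)
  obtain ⟨hyt, hy⟩ := (key y).1 hy
  obtain ⟨α, hα, h⟩ := exists_ord_bound_of_forall (fun z α => z ε V α) y (fun z hz => by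
    by_contra h
    exact hy' z hz ((key z).2 ⟨ht y hyt z hz, h⟩))
    fun x α β hα hβ h => V_mono hα hβ h x
  exact hy ⟨succ α, hα.succ, (mem_V_succ hα).2 h⟩

/-- A nonempty definable class has an element none of whose elements belongs to the class. -/
theorem exists_min_of_dfn {P : M → Prop} [Dfn Set.univ fun v => P (v 0)] {x : M} (hx : P x) :
    ∃ y, P y ∧ ∀ z, z ε y → ¬ P z := by
  obtain ⟨t, ht, hxt⟩ := exists_isTr x
  have key : ∀ y, y ε cls (fun y => y ε t ∧ P y) ↔ y ε t ∧ P y := mem_cls t fun y h => h.1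
  obtain ⟨y, hy, hy'⟩ := exists_min ((key x).2 ⟨hxt, hx⟩)
  obtain ⟨hyt, hy⟩ := (key y).1 hy
  exact ⟨y, hy, fun z hz hz' => hy' z hz ((key z).2 ⟨ht y hyt z hz, hz'⟩)⟩

end Hierarchy

/-! ### Assignments of values to variables -/

section Assignments

variable {M : Type u} [setLang.Structure M] [hM : ZFModel M] {A : Set M}

/-- `s` is a function from the natural numbers of `M` to `a`. -/
def IsAsg (s a : M) : Prop :=
  (∀ z, z ε s → ∃ i y, IsNat i ∧ y ε a ∧ z = pair i y) ∧
    ∀ i, IsNat i → ∃ y, ∀ w, pair i w ε s ↔ w = y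

instance {t s : (ℕ → M) → M} [DfnTerm A t] [DfnTerm A s] : Dfn A fun v => IsAsg (t v) (s v) :=
  Dfn.subst₂ (by unfold IsAsg; infer_instance)

/-- The set of functions from the natural numbers of `M` to `a`. -/
noncomputable def asg (a : M) : M := cls fun s => IsAsg s a

instance {t : (ℕ → M) → M} [DfnTerm A t] : DfnTerm A fun v => asg (t v) :=
  DfnTerm.subst₁ (by unfold asg; infer_instance)

theorem pair_mem_V {θ x y : M} (hθ : IsOrd θ) (hx : x ε V θ) (hy : y ε V θ) :
    pair x y ε V (succ (succ θ)) := by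
  rw [mem_V_succ hθ.succ]
  intro z hz
  rw [mem_V_succ hθ]
  intro w hw
  rcases mem_upair.1 hz with rfl | rfl <;> rcases mem_upair.1 hw with rfl | rfl <;> assumption

-- Pairs of elements of `V θ` lie two levels higher, so assignments lie three levels higher. This
-- bound takes the place of cartesian products.
@[simp] theorem mem_asg {s a : M} : s ε asg a ↔ IsAsg s a := by
  obtain ⟨θ, hθ, h⟩ := exists_mem_V (cup om a)
  refine mem_cls (P := fun s => IsAsg s a) (V (succ (succ (succ θ)))) (fun s hs => ?_) s
  rw [mem_V_succ hθ.succ.succ]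
  intro z hz
  obtain ⟨i, y, hi, hy, rfl⟩ := hs.1 z hz
  exact pair_mem_V hθ (isTr_V hθ _ h _ (mem_cup.2 (Or.inl (mem_om.2 hi))))
    (isTr_V hθ _ h _ (mem_cup.2 (Or.inr hy)))

theorem IsAsg.pair_mem {s a i w : M} (h : IsAsg s a) (hi : IsNat i) :
    pair i w ε s ↔ w = ap s i := by
  obtain ⟨y, hy⟩ := h.2 i hi
  rw [ap_eq hy, hy]

theorem IsAsg.ap_mem {s a i : M} (h : IsAsg s a) (hi : IsNat i) : ap s i ε a := by
  obtain ⟨j, y, hj, hy, e⟩ := h.1 _ ((h.pair_mem hi).2 rfl)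
  rwa [(pair_inj.1 e).2]

theorem IsAsg.mem_iff {s a z : M} (h : IsAsg s a) :
    z ε s ↔ ∃ i, IsNat i ∧ z = pair i (ap s i) := by
  constructor
  · intro hz
    obtain ⟨i, y, hi, -, rfl⟩ := h.1 z hz
    exact ⟨i, hi, by rw [(h.pair_mem hi).1 hz]⟩
  · rintro ⟨i, hi, rfl⟩
    exact (h.pair_mem hi).2 rfl

theorem IsAsg.ext {s t a b : M} (h : IsAsg s a) (h' : IsAsg t b)
    (e : ∀ i, IsNat i → ap s i = ap t i) : s = t := by
  apply SetModel.ext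
  intro z
  rw [h.mem_iff, h'.mem_iff]
  refine exists_congr fun i => and_congr_right fun hi => ?_
  rw [e i hi]

theorem IsAsg.mono {s a b : M} (h : IsAsg s a) (hab : IsSub a b) : IsAsg s b := by
  refine ⟨fun z hz => ?_, h.2⟩
  obtain ⟨i, y, hi, hy, rfl⟩ := h.1 z hz
  exact ⟨i, y, hi, hab y hy, rfl⟩

/-- The function `s`, with the value at `i` changed to `x`. -/
noncomputable def upd (s i x : M) : M :=
  cls fun z => (z ε s ∧ ∀ y, z ≠ pair i y) ∨ z = pair i x

theorem mem_upd {s i x z : M} : z ε upd s i x ↔ (z ε s ∧ ∀ y, z ≠ pair i y) ∨ z = pair i x := by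
  refine mem_cls (cup s (upair (pair i x) (pair i x))) (fun z hz => ?_) z
  rcases hz with hz | rfl
  · exact mem_cup.2 (Or.inl hz.1)
  · simp

instance {t s r : (ℕ → M) → M} [DfnTerm A t] [DfnTerm A s] [DfnTerm A r] :
    DfnTerm A fun v => upd (t v) (s v) (r v) :=
  DfnTerm.subst₃ (by unfold upd; infer_instance)

theorem pair_mem_upd {s i x j w : M} :
    pair j w ε upd s i x ↔ (j ≠ i ∧ pair j w ε s) ∨ (j = i ∧ w = x) := by
  rw [mem_upd, pair_inj]
  refine or_congr_left ⟨fun h => ⟨fun e => h.2 w (by rw [e]), h.1⟩, fun h => ⟨h.2, fun y e => ?_⟩⟩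
  exact h.1 (pair_inj.1 e).1

theorem IsAsg.upd {s a i x : M} (h : IsAsg s a) (hi : IsNat i) (hx : x ε a) :
    IsAsg (upd s i x) a := by
  refine ⟨fun z hz => ?_, fun j hj => ?_⟩
  · rcases mem_upd.1 hz with hz | rfl
    · exact h.1 z hz.1
    · exact ⟨i, x, hi, hx, rfl⟩
  · by_cases hij : j = i
    · exact ⟨x, fun w => by rw [pair_mem_upd]; simp [hij]⟩
    · exact ⟨ap s j, fun w => by rw [pair_mem_upd, h.pair_mem hj]; simp [hij]⟩

@[simp] theorem ap_upd_self {s i x : M} : ap (SetModel.upd s i x) i = x :=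
  ap_eq fun w => by rw [pair_mem_upd]; simp

theorem ap_upd_of_ne {s i j x : M} (hij : j ≠ i) :
    ap (SetModel.upd s i x) j = ap s j := by
  unfold ap
  congr 1
  funext w
  rw [pair_mem_upd]
  simp [hij]

theorem ap_upd_num_of_ne {s x : M} {i j : ℕ} (hij : j ≠ i) :
    ap (SetModel.upd s (num i) x) (num j) = ap s (num j) :=
  ap_upd_of_ne fun h => hij (num_injective h)

/-- The function on the natural numbers with constant value `∅`. -/
noncomputable def zeroAsg : M := cls fun z => ∃ i, IsNat i ∧ z = pair i emp

instance : DfnTerm A fun _ => zeroAsg := by unfold zeroAsg; infer_instance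

theorem mem_zeroAsg {z : M} : z ε zeroAsg ↔ ∃ i, IsNat i ∧ z = pair i emp := by
  refine mem_cls (image (fun i => pair i emp) om) (fun z hz => ?_) z
  obtain ⟨i, hi, rfl⟩ := hz
  exact mem_image.2 ⟨i, mem_om.2 hi, rfl⟩

theorem pair_mem_zeroAsg {i w : M} : pair i w ε zeroAsg ↔ IsNat i ∧ w = emp := by
  rw [mem_zeroAsg]
  constructor
  · rintro ⟨j, hj, e⟩
    obtain ⟨rfl, rfl⟩ := pair_inj.1 e
    exact ⟨hj, rfl⟩
  · rintro ⟨h, rfl⟩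
    exact ⟨i, h, rfl⟩

theorem isAsg_zeroAsg {a : M} (h : emp ε a) : IsAsg zeroAsg a := by
  refine ⟨fun z hz => ?_, fun i hi => ⟨emp, fun w => by simp [pair_mem_zeroAsg, hi]⟩⟩
  obtain ⟨i, hi, rfl⟩ := mem_zeroAsg.1 hz
  exact ⟨i, emp, hi, h, rfl⟩

end Assignments

/-! ### Standard formulas and their satisfaction -/

/-- Formulas of set theory with named variables. -/
inductive PF : Type
  | fal : PF
  | mem (i j : ℕ) : PF
  | eq (i j : ℕ) : PF
  | imp (p q : PF) : PF
  | all (i : ℕ) (p : PF) : PF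

section Satisfaction

variable {M : Type u} [setLang.Structure M] [hM : ZFModel M] {A : Set M}

/-- Satisfaction of a formula by an assignment `s` in `M`, with quantifiers restricted to `X`. -/
def Sat (X : M → Prop) : PF → M → Prop
  | .fal, _ => False
  | .mem i j, s => ap s (num i) ε ap s (num j)
  | .eq i j, s => ap s (num i) = ap s (num j)
  | .imp p q, s => Sat X p s → Sat X q s
  | .all i p, s => ∀ x, X x → Sat X p (upd s (num i) x)

/-- The recursion on `ψ` is external and yields a separate formula of set theory for each `ψ`; no
truth predicate inside `M` is involved. -/
instance Dfn.satMem (ψ : PF) {t s : (ℕ → M) → M} [DfnTerm A t] [DfnTerm A s] :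
    Dfn A fun v => Sat (· ε t v) ψ (s v) := by
  refine Dfn.subst₂ (P := fun x y => Sat (· ε x) ψ y) ?_
  induction ψ with
  | fal => exact Dfn.false
  | mem i j => unfold Sat; infer_instance
  | eq i j => unfold Sat; infer_instance
  | imp p q ih ih' => unfold Sat; infer_instance
  | all i p ih =>
    have : Dfn A fun v => Sat (· ε v 1) p (SetModel.upd (v 2) (num i) (v 0)) :=
      Dfn.subst₂ (P := fun x y => Sat (· ε x) p y) ih
    have := this.rename fun n => n.casesOn 0 fun m => m.casesOn 1 fun _ => 2
    unfold Sat
    exact Dfn.all (P := fun v x => x ε v 0 → Sat (· ε v 0) p (SetModel.upd (v 1) (num i) x))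

instance Dfn.satTrue (ψ : PF) {s : (ℕ → M) → M} [DfnTerm A s] :
    Dfn A fun v => Sat (fun _ => True) ψ (s v) := by
  refine Dfn.subst₁ (P := fun y => Sat (fun _ => True) ψ y) ?_
  induction ψ with
  | fal => exact Dfn.false
  | mem i j => unfold Sat; infer_instance
  | eq i j => unfold Sat; infer_instance
  | imp p q ih ih' => unfold Sat; infer_instance
  | all i p ih =>
    have : ∀ s : (ℕ → M) → M, [DfnTerm A s] → Dfn A fun v => Sat (fun _ => True) p (s v) :=
      fun s _ => Dfn.subst₁ (P := fun y => Sat (fun _ => True) p y) ih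
    unfold Sat
    infer_instance

/-- Number 0 is reserved for the free variable, and bound variable `i` gets number `i + 1`. -/
theorem exists_var_of_term {n : ℕ} (t : setLang.Term (Fin 1 ⊕ Fin n)) :
    ∃ k, ∀ (s : M) (xs : Fin n → M), (∀ i : Fin n, ap s (num (i + 1)) = xs i) →
      t.realize (Sum.elim (fun _ => ap s (num 0)) xs) = ap s (num k) := by
  rcases t with (i | i) | ⟨f, -⟩
  · exact ⟨0, fun s xs h => rfl⟩
  · exact ⟨i + 1, fun s xs h => (h i).symm⟩
  · exact f.elim

/-- Every formula is equivalent in `M` to one with named variables. -/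
theorem exists_pf {n : ℕ} (φ : setLang.BoundedFormula (Fin 1) n) :
    ∃ ψ : PF, ∀ (a s : M) (xs : Fin n → M), IsAsg s a → (∀ i : Fin n, ap s (num (i + 1)) = xs i) →
      (φ.Realize (fun _ => ap s (num 0)) xs ↔ Sat (fun _ => True) ψ s) := by
  induction φ with
  | falsum => exact ⟨.fal, fun a s xs _ _ => Iff.rfl⟩
  | equal t₁ t₂ =>
    obtain ⟨i, hi⟩ := exists_var_of_term (M := M) t₁
    obtain ⟨j, hj⟩ := exists_var_of_term (M := M) t₂
    refine ⟨.eq i j, fun a s xs _ h => ?_⟩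
    unfold BoundedFormula.Realize Sat
    rw [hi s xs h, hj s xs h]
  | @rel n l R ts =>
    cases R
    obtain ⟨i, hi⟩ := exists_var_of_term (M := M) (ts 0)
    obtain ⟨j, hj⟩ := exists_var_of_term (M := M) (ts 1)
    refine ⟨.mem i j, fun a s xs _ h => ?_⟩
    unfold BoundedFormula.Realize Sat E
    rw [← hi s xs h, ← hj s xs h]
    apply iff_of_eq; congr 1
    funext k
    fin_cases k <;> rfl
  | imp p q ih ih' =>
    obtain ⟨ψ, hψ⟩ := ih
    obtain ⟨ψ', hψ'⟩ := ih'
    refine ⟨.imp ψ ψ', fun a s xs hs h => ?_⟩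
    unfold BoundedFormula.Realize Sat
    rw [hψ a s xs hs h, hψ' a s xs hs h]
  | @all n p ih =>
    obtain ⟨ψ, hψ⟩ := ih
    refine ⟨.all (n + 1) ψ, fun a s xs hs h => ?_⟩
    unfold BoundedFormula.Realize Sat
    refine forall_congr' fun x => ?_
    have e : ap (SetModel.upd s (num (n + 1)) x) (num 0) = ap s (num 0) :=
      ap_upd_num_of_ne (Nat.succ_ne_zero n).symm
    -- The quantified `x` need not lie in `a`, so the codomain of the assignment is enlarged by it.
    rw [← e, hψ (cup a (upair x x)) (SetModel.upd s (num (n + 1)) x) (Fin.snoc xs x)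
      ((hs.mono fun z hz => mem_cup.2 (Or.inl hz)).upd (isNat_num _) (by simp))]
    · simp
    · intro i
      refine Fin.lastCases ?_ (fun i => ?_) i
      · simp
      · rw [Fin.snoc_castSucc, ← h i, Fin.val_castSucc]
        exact ap_upd_num_of_ne (by omega)

end Satisfaction

/-! ### The reflection principle -/

section Reflection

variable {M : Type u} [setLang.Structure M]

/-- `θ` is a limit ordinal closed under the relation `C`. -/
def IsClosedUnder (C : M → M → Prop) (θ : M) : Prop :=
  IsOrd θ ∧ ∀ α, α ε θ → ∃ β, β ε θ ∧ α ε β ∧ C α β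

theorem IsClosedUnder.mono {C D : M → M → Prop} {θ : M} (h : IsClosedUnder C θ)
    (h' : ∀ α β, C α β → D α β) : IsClosedUnder D θ := by
  refine ⟨h.1, fun α hα => ?_⟩
  obtain ⟨β, h₁, h₂, h₃⟩ := h.2 α hα
  exact ⟨β, h₁, h₂, h' _ _ h₃⟩

variable [hM : ZFModel M]

theorem IsOrd.exists_max {α β : M} (hα : IsOrd α) (hβ : IsOrd β) :
    ∃ γ, (γ = α ∨ γ = β) ∧ IsOrd γ ∧ IsSub α γ ∧ IsSub β γ := by
  rcases hα.sub_or_mem hβ with h | h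
  · exact ⟨β, Or.inr rfl, hβ, h, IsSub.refl β⟩
  · exact ⟨α, Or.inl rfl, hα, IsSub.refl α, hα.1 β h⟩

/-- A definable relation on the ordinals which is antitone in the first variable and monotone in
the second, and which holds for arbitrary `α` and large enough `β`. -/
structure IsClosureRel (C : M → M → Prop) : Prop where
  dfn : Dfn Set.univ fun v => C (v 0) (v 1)
  mono : ∀ {α α' β β'}, IsOrd α → IsOrd α' → IsOrd β → IsOrd β' → IsSub α' α → IsSub β β' →
    C α β → C α' β'
  total : ∀ α, IsOrd α → ∃ β, IsOrd β ∧ C α β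

/-- Monotonicity allows passing to a common bound, so a single relation can serve all subformulas of
a formula. -/
theorem IsClosureRel.and {C D : M → M → Prop} (hC : IsClosureRel C) (hD : IsClosureRel D) :
    IsClosureRel fun α β => C α β ∧ D α β where
  dfn := have := hC.dfn; have := hD.dfn; inferInstance
  mono h₁ h₂ h₃ h₄ h₅ h₆ h := ⟨hC.mono h₁ h₂ h₃ h₄ h₅ h₆ h.1, hD.mono h₁ h₂ h₃ h₄ h₅ h₆ h.2⟩
  total α hα := by
    obtain ⟨β, hβ, h⟩ := hC.total α hα
    obtain ⟨γ, hγ, h'⟩ := hD.total α hα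
    obtain ⟨δ, -, hδ, h₁, h₂⟩ := hβ.exists_max hγ
    exact ⟨δ, hδ, hC.mono hα hα hβ hδ (IsSub.refl α) h₁ h, hD.mono hα hα hγ hδ (IsSub.refl α) h₂ h'⟩

theorem isClosureRel_mem : IsClosureRel fun α β : M => α ε β where
  dfn := inferInstance
  mono _ h₂ h₃ _ h₅ h₆ h := h₆ _ (h₂.mem_of_sub_of_mem h₃ h₅ h)
  total α hα := ⟨succ α, hα.succ, mem_succ.2 (Or.inr rfl)⟩

theorem IsClosedUnder.exists_mem_V {C : M → M → Prop} {θ x : M} (h : IsClosedUnder C θ)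
    (hx : x ε V θ) : ∃ α, α ε θ ∧ x ε V α := by
  obtain ⟨β, h₁, h₂⟩ := (mem_V h.1).1 hx
  obtain ⟨γ, h₃, h₄, -⟩ := h.2 β h₁
  exact ⟨γ, h₃, (mem_V (h.1.mem h₃)).2 ⟨β, h₄, h₂⟩⟩

/-- There are arbitrarily large ordinals closed under a closure relation. -/
theorem IsClosureRel.exists_isClosedUnder {C : M → M → Prop} (hC : IsClosureRel C) {α₀ : M}
    (h₀ : IsOrd α₀) : ∃ θ, IsClosedUnder C θ ∧ α₀ ε θ := by
  have dC : ∀ t s : (ℕ → M) → M, [DfnTerm Set.univ t] → [DfnTerm Set.univ s] →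
      Dfn Set.univ fun v => C (t v) (s v) := fun t s _ _ => Dfn.subst₂ hC.dfn
  -- The recursion dominates `α₀` and all earlier values. Only the values at natural numbers are
  -- used, and their supremum is the desired `θ`.
  let G : M → M := fun h => leastOrd fun β => α₀ ε β ∧ ∀ γ y, pair γ y ε h → y ε β ∧ C y β
  let f : M → M := ordRec G
  have dG : DfnTerm Set.univ fun v => G (v 0) := by
    refine DfnTerm.leastOrd (P := fun v β => α₀ ε β ∧ ∀ γ y, pair γ y ε v 0 → y ε β ∧ C y β)
  have df : ∀ t : (ℕ → M) → M, [DfnTerm Set.univ t] → DfnTerm Set.univ fun v => f (t v) :=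
    fun t _ => DfnTerm.ordRec
  have hf : ∀ α, IsOrd α → IsOrd (f α) ∧ α₀ ε f α ∧ ∀ γ, γ ε α → f γ ε f α ∧ C (f γ) (f α) := by
    intro α hα
    refine IsOrd.induction (P := fun α =>
      IsOrd (f α) ∧ α₀ ε f α ∧ ∀ γ, γ ε α → f γ ε f α ∧ C (f γ) (f α)) ?_ hα
    intro α hα ih
    have hD := isClosureRel_mem.and hC
    -- The premise `IsOrd (f γ)` makes the relation monotone for arbitrary `γ`, as collection
    -- requires.
    obtain ⟨β, hβ, h⟩ := exists_ord_bound_of_forall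
      (fun γ β => IsOrd (f γ) → f γ ε β ∧ C (f γ) β) α
      (fun γ hγ => by
        obtain ⟨β, hβ, h⟩ := hD.total _ (ih γ hγ).1
        exact ⟨β, hβ, fun _ => h⟩)
      (fun γ β β' hβ hβ' h h' hγ => hD.mono hγ hγ hβ hβ' (IsSub.refl _) h (h' hγ))
    obtain ⟨δ, -, hδ, h₁, h₂⟩ := hβ.exists_max h₀.succ
    have hG : ∀ H δ, IsOrd δ → (α₀ ε δ ∧ ∀ γ y, pair γ y ε H → y ε δ ∧ C y δ) →
        IsOrd (G H) ∧ α₀ ε G H ∧ ∀ γ y, pair γ y ε H → y ε G H ∧ C y (G H) :=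
      fun H δ hδ h => (leastOrd_spec hδ h).1
    obtain ⟨k₁, k₂, k₃⟩ := hG (hist G α) δ hδ
      ⟨h₂ _ (mem_succ.2 (Or.inr rfl)), fun γ y hy => by
        obtain ⟨hγ, rfl⟩ := (pair_mem_hist hα).1 hy
        have := (ih γ hγ).1
        exact hD.mono this this hβ hδ (IsSub.refl _) h₁ (h γ hγ this)⟩
    exact ⟨k₁, k₂, fun γ hγ => k₃ γ (f γ) ((pair_mem_hist hα).2 ⟨hγ, rfl⟩)⟩
  have hθ : IsOrd (sUn (image f om)) := isOrd_sUn fun y hy => by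
    obtain ⟨n, hn, rfl⟩ := mem_image.1 hy
    exact (hf n (isOrd_om.mem hn)).1
  have mem_θ : ∀ x, x ε sUn (image f om) ↔ ∃ n, n ε om ∧ x ε f n := by
    intro x
    rw [mem_sUn]
    constructor
    · rintro ⟨y, hy, hx⟩
      obtain ⟨n, hn, rfl⟩ := mem_image.1 hy
      exact ⟨n, hn, hx⟩
    · rintro ⟨n, hn, hx⟩
      exact ⟨f n, mem_image.2 ⟨n, hn, rfl⟩, hx⟩
  refine ⟨sUn (image f om), ⟨hθ, fun α hα => ?_⟩, (mem_θ α₀).2 ⟨emp, mem_om.2 isNat_emp,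
    (hf emp isOrd_emp).2.1⟩⟩
  obtain ⟨n, hn, hα'⟩ := (mem_θ α).1 hα
  have hn' := (mem_om.1 hn).succ
  obtain ⟨h₁, -, -⟩ := hf n (isOrd_om.mem hn)
  obtain ⟨h₂, -, h₃⟩ := hf (succ n) hn'.1
  obtain ⟨h₃, h₄⟩ := h₃ n (mem_succ.2 (Or.inr rfl))
  refine ⟨f (succ n), (mem_θ _).2 ⟨succ (succ n), mem_om.2 hn'.succ,
    ((hf _ hn'.succ.1).2.2 _ (mem_succ.2 (Or.inr rfl))).1⟩, h₂.1 _ h₃ _ hα', ?_⟩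
  exact hC.mono h₁ (h₁.mem hα') h₂ h₂ (h₁.1 _ hα') (IsSub.refl _) h₄

/-- The reflection principle. -/
theorem exists_isClosureRel_reflecting (ψ : PF) :
    ∃ C : M → M → Prop, IsClosureRel C ∧ ∀ θ, IsClosedUnder C θ →
      ∀ α, α ε θ → ∀ s, IsAsg s (V α) → (Sat (· ε V θ) ψ s ↔ Sat (fun _ => True) ψ s) := by
  induction ψ with
  | fal => exact ⟨_, isClosureRel_mem, fun θ _ α _ s _ => Iff.rfl⟩
  | mem i j => exact ⟨_, isClosureRel_mem, fun θ _ α _ s _ => Iff.rfl⟩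
  | eq i j => exact ⟨_, isClosureRel_mem, fun θ _ α _ s _ => Iff.rfl⟩
  | imp p q ih ih' =>
    obtain ⟨C, hC, h⟩ := ih
    obtain ⟨D, hD, h'⟩ := ih'
    refine ⟨_, hC.and hD, fun θ hθ α hα s hs => ?_⟩
    unfold Sat
    rw [h θ (hθ.mono fun _ _ h => h.1) α hα s hs, h' θ (hθ.mono fun _ _ h => h.2) α hα s hs]
  | all i p ih =>
    obtain ⟨C, hC, h⟩ := ih
    -- The Tarski–Vaught condition: if `p` fails for some value of the quantified variable, it fails
    -- for one in `V β`.
    let R : M → M → Prop := fun s β => (∃ x, ¬ Sat (fun _ => True) p (upd s (num i) x)) →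
      ∃ x, x ε V β ∧ ¬ Sat (fun _ => True) p (upd s (num i) x)
    have hR : ∀ s α β, IsOrd α → IsOrd β → IsSub α β → R s α → R s β := by
      intro s α β hα hβ hαβ h hx
      obtain ⟨x, hx, hx'⟩ := h hx
      exact ⟨x, V_mono hα hβ hαβ x hx, hx'⟩
    have hD : IsClosureRel fun α β : M => ∀ s, IsAsg s (V α) → R s β :=
      { dfn := inferInstance
        mono := fun h₁ h₂ h₃ h₄ h₅ h₆ h s hs =>
          hR s _ _ h₃ h₄ h₆ (h s (hs.mono (V_mono h₂ h₁ h₅)))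
        total := fun α hα => by
          obtain ⟨β, hβ, h⟩ := exists_ord_bound_of_forall R (asg (V α)) (fun s hs => by
            by_cases hx : ∃ x, ¬ Sat (fun _ => True) p (upd s (num i) x)
            · obtain ⟨x, hx⟩ := hx
              obtain ⟨β, hβ, h⟩ := exists_mem_V x
              exact ⟨β, hβ, fun _ => ⟨x, h, hx⟩⟩
            · exact ⟨emp, isOrd_emp, fun h => absurd h hx⟩) hR
          exact ⟨β, hβ, fun s hs => h s (mem_asg.2 hs)⟩ }
    refine ⟨_, hC.and hD, fun θ hθ α hα s hs => ?_⟩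
    have key : ∀ β, β ε θ → ∀ x, x ε V β →
        (Sat (· ε V θ) p (upd s (num i) x) ↔ Sat (fun _ => True) p (upd s (num i) x)) := by
      intro β hβ x hx
      have hα' := hθ.1.mem hα
      have hβ' := hθ.1.mem hβ
      obtain ⟨γ, hγ, hγ', h₁, h₂⟩ := hα'.exists_max hβ'
      refine h θ (hθ.mono fun _ _ h => h.1) γ (by rcases hγ with rfl | rfl <;> assumption) _ ?_
      exact (hs.mono (V_mono hα' hγ' h₁)).upd (isNat_num i) (V_mono hβ' hγ' h₂ x hx)
    unfold Sat
    constructor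
    · intro hx
      by_contra hn
      push Not at hn
      obtain ⟨x, -, hn⟩ := hn
      obtain ⟨β, hβ, -, -, h'⟩ := hθ.2 α hα
      obtain ⟨x, hxβ, hn⟩ := h' s hs ⟨x, hn⟩
      exact hn ((key β hβ x hxβ).1 (hx x (V_mono (hθ.1.mem hβ) hθ.1 (hθ.1.1 β hβ) x hxβ)))
    · intro hx x hxθ
      obtain ⟨β, hβ, hxβ⟩ := hθ.exists_mem_V hxθ
      exact (key β hβ x hxβ).2 (hx x trivial)

end Reflection

/-! ### Enumeration of truth sets and indices of sets -/

section Enumeration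

variable {M : Type u} [setLang.Structure M] [hM : ZFModel M] {A : Set M}

/-- The assignment with value `y` at `0` and `∅` elsewhere. -/
noncomputable def pointAsg (y : M) : M := upd zeroAsg emp y

instance {t : (ℕ → M) → M} [DfnTerm A t] : DfnTerm A fun v => pointAsg (t v) :=
  DfnTerm.subst₁ (by unfold pointAsg; infer_instance)

theorem IsAsg.pointAsg {a y : M} (h : emp ε a) (hy : y ε a) : IsAsg (pointAsg y) a :=
  (isAsg_zeroAsg h).upd isNat_emp hy

@[simp] theorem ap_pointAsg {y : M} : ap (pointAsg y) emp = y := ap_upd_self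

/-- A definable element of `M` is definable in some level of the cumulative hierarchy. -/
theorem exists_pf_of_dfn {a : M} (h : Dfn ∅ fun v => v 0 = a) :
    ∃ (ψ : PF) (θ : M), IsOrd θ ∧ emp ε θ ∧ a ε V θ ∧
      ∀ y, y ε V θ → (Sat (· ε V θ) ψ (pointAsg y) ↔ y = a) := by
  obtain ⟨φ, hφ⟩ := h.out
  -- The equivalence holds for every valuation, in particular for constant ones, so all variables
  -- may be identified with one.
  let g : (∅ : Set M) ⊕ ℕ → Fin 1 := fun _ => 0
  obtain ⟨ψ, hψ⟩ := exists_pf (M := M) (φ.relabel g : setLang.Formula (Fin 1))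
  obtain ⟨C, hC, h⟩ := exists_isClosureRel_reflecting (M := M) ψ
  obtain ⟨α₀, h₀, ha⟩ := exists_mem_V a
  obtain ⟨θ, hθ, hα₀⟩ := hC.exists_isClosedUnder h₀
  refine ⟨ψ, θ, hθ.1, isOrd_emp.mem_of_sub_of_mem hθ.1 (fun z hz => by simp at hz) hα₀,
    V_mono h₀ hθ.1 (hθ.1.1 _ hα₀) a ha, fun y hy => ?_⟩
  obtain ⟨α, hα, hyα⟩ := hθ.exists_mem_V hy
  have hα' := hθ.1.mem hα
  have hs : IsAsg (pointAsg y) (V α) := by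
    refine IsAsg.pointAsg ?_ hyα
    obtain ⟨β, hβ, -⟩ := (mem_V hα').1 hyα
    exact (mem_V hα').2 ⟨β, hβ, fun z hz => by simp at hz⟩
  rw [h θ hθ α hα _ hs, ← hψ (V α) (pointAsg y) default hs (fun i => i.elim0)]
  have e : ap (pointAsg y) (num 0) = y := ap_pointAsg
  rw [e, ← hφ fun _ => y]
  refine (Formula.realize_relabel (φ := φ) (g := g)).trans ?_
  apply iff_of_eq; congr 1
  funext i
  rcases i with i | i
  · exact i.2.elim
  · rfl

/-- The operations under which the range of the enumeration is to be closed. They produce the truth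
sets of formulas in `V l`. -/
noncomputable def truthOp (i l b c R S : M) : M :=
  cls fun s => IsAsg s (V l) ∧ ((i = num 0 ∧ ap s b ε ap s c) ∨ (i = num 1 ∧ ap s b = ap s c) ∨
    (i = num 2 ∧ (s ε R → s ε S)) ∨ (i = num 3 ∧ ∀ x, x ε V l → upd s b x ε S))

theorem mem_truthOp {i l b c R S s : M} : s ε truthOp i l b c R S ↔
    IsAsg s (V l) ∧ ((i = num 0 ∧ ap s b ε ap s c) ∨ (i = num 1 ∧ ap s b = ap s c) ∨
    (i = num 2 ∧ (s ε R → s ε S)) ∨ (i = num 3 ∧ ∀ x, x ε V l → upd s b x ε S)) :=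
  mem_cls (asg (V l)) (fun _ h => mem_asg.2 h.1) s

/-- One of the operations, applied to values of the function `h`, gives a set outside the range
of `h`. -/
def IsNew (h i l b c : M) : Prop :=
  (IsOrd i ∧ IsOrd l ∧ IsOrd b ∧ IsOrd c) ∧
    ∀ δ y, pair δ y ε h → y ≠ truthOp i l b c (ap h b) (ap h c)

/-- The least level `l` at which one of the operations gives a new set. -/
noncomputable def newLevel (h : M) : M := leastOrd fun l => ∃ i b c, IsNew h i l b c

instance {t : (ℕ → M) → M} [DfnTerm A t] : DfnTerm A fun v => newLevel (t v) :=
  DfnTerm.subst₁ (by unfold newLevel IsNew truthOp; infer_instance)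

/-- The least first argument of an operation which gives a new set at that level. -/
noncomputable def newFst (h : M) : M := leastOrd fun b => ∃ i c, IsNew h i (newLevel h) b c

instance {t : (ℕ → M) → M} [DfnTerm A t] : DfnTerm A fun v => newFst (t v) :=
  DfnTerm.subst₁ (by unfold newFst IsNew truthOp; infer_instance)

/-- The least second argument belonging to that first argument. -/
noncomputable def newSnd (h : M) : M := leastOrd fun c => ∃ i, IsNew h i (newLevel h) (newFst h) c

instance {t : (ℕ → M) → M} [DfnTerm A t] : DfnTerm A fun v => newSnd (t v) :=
  DfnTerm.subst₁ (by unfold newSnd IsNew truthOp; infer_instance)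

/-- The least index of an operation which gives a new set for these arguments. -/
noncomputable def newIndex (h : M) : M :=
  leastOrd fun i => IsNew h i (newLevel h) (newFst h) (newSnd h)

instance {t : (ℕ → M) → M} [DfnTerm A t] : DfnTerm A fun v => newIndex (t v) :=
  DfnTerm.subst₁ (by unfold newIndex IsNew truthOp; infer_instance)

/-- The first set outside the range of `h` which one of the operations gives. -/
noncomputable def enumStep (h : M) : M :=
  truthOp (newIndex h) (newLevel h) (newFst h) (newSnd h) (ap h (newFst h)) (ap h (newSnd h))

instance {t : (ℕ → M) → M} [DfnTerm A t] : DfnTerm A fun v => enumStep (t v) :=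
  DfnTerm.subst₁ (by unfold enumStep truthOp; infer_instance)

/-- A function on the ordinals whose range is closed under the operations `truthOp`. -/
noncomputable def enum (α : M) : M := ordRec enumStep α

instance {t : (ℕ → M) → M} [DfnTerm A t] : DfnTerm A fun v => enum (t v) :=
  DfnTerm.subst₁ (by unfold enum; infer_instance)

/-- Four successive minimisations, each leaving witnesses for the next. The level comes first, which
is what bounds it by `l`. -/
theorem IsNew.least {h i l b c : M} (H : IsNew h i l b c) :
    IsNew h (newIndex h) (newLevel h) (newFst h) (newSnd h) ∧ IsSub (newLevel h) l := by
  have : Dfn Set.univ fun v => ∃ i b c, IsNew h i (v 0) b c := by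
    unfold IsNew truthOp; infer_instance
  have : Dfn Set.univ fun v => ∃ i c, IsNew h i (newLevel h) (v 0) c := by
    unfold IsNew truthOp; infer_instance
  have : Dfn Set.univ fun v => ∃ i, IsNew h i (newLevel h) (newFst h) (v 0) := by
    unfold IsNew truthOp; infer_instance
  have : Dfn Set.univ fun v => IsNew h (v 0) (newLevel h) (newFst h) (newSnd h) := by
    unfold IsNew truthOp; infer_instance
  obtain ⟨⟨-, i, b, c, H⟩, hl⟩ := leastOrd_spec (P := fun l => ∃ i b c, IsNew h i l b c)
    H.1.2.1 ⟨i, b, c, H⟩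
  obtain ⟨⟨-, i, c, H⟩, -⟩ := leastOrd_spec (P := fun b => ∃ i c, IsNew h i (newLevel h) b c)
    H.1.2.2.1 ⟨i, c, H⟩
  obtain ⟨⟨-, i, H⟩, -⟩ := leastOrd_spec (P := fun c => ∃ i, IsNew h i (newLevel h) (newFst h) c)
    H.1.2.2.2 ⟨i, H⟩
  obtain ⟨⟨-, H⟩, -⟩ := leastOrd_spec
    (P := fun i => IsNew h i (newLevel h) (newFst h) (newSnd h)) H.1.1 H
  exact ⟨H, hl⟩

/-- A result that is never listed remains a candidate at every late stage. Each such stage then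
lists a new set of level at most `l`, so `enum` maps a tail of the ordinals injectively into the
power set of `asg (V l)`, against replacement. -/
theorem exists_enum_eq {i l b c : M} (hi : IsOrd i) (hl : IsOrd l) (hb : IsOrd b) (hc : IsOrd c) :
    ∃ δ, IsOrd δ ∧ enum δ = truthOp i l b c (enum b) (enum c) := by
  by_contra hn
  push Not at hn
  -- From `α₀` on the history is defined at `b` and `c` and agrees there with `enum`.
  obtain ⟨α₀, -, hα₀, hb₀, hc₀⟩ := hb.succ.exists_max hc.succ
  have key : ∀ α, IsOrd α → IsSub α₀ α →
      (∀ δ, δ ε α → enum δ ≠ enum α) ∧ enum α ε pow (asg (V l)) := by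
    intro α hα h
    have hbα : b ε α := h _ (hb₀ _ (mem_succ.2 (Or.inr rfl)))
    have hcα : c ε α := h _ (hc₀ _ (mem_succ.2 (Or.inr rfl)))
    have H : IsNew (hist enumStep α) i l b c := by
      refine ⟨⟨hi, hl, hb, hc⟩, fun δ y hy => ?_⟩
      obtain ⟨hδ, rfl⟩ := (pair_mem_hist hα).1 hy
      rw [ap_hist hα hbα, ap_hist hα hcα]
      exact hn δ (hα.mem hδ)
    obtain ⟨H', hl'⟩ := H.least
    refine ⟨fun δ hδ => H'.2 δ _ ((pair_mem_hist hα).2 ⟨hδ, rfl⟩), mem_pow.2 fun s hs => ?_⟩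
    exact mem_asg.2 ((mem_truthOp.1 hs).1.mono (V_mono H'.1.2.1 hl hl'))
  -- The inverse of `enum` on the tail from `α₀` is a definable function on a set, hence bounded by
  -- some `κ`; a stage at or beyond both `κ` and `α₀` contradicts this.
  obtain ⟨κ, hκ, h⟩ := exists_ord_bound_image
    (fun y => leastOrd fun α => IsSub α₀ α ∧ enum α = y) (pow (asg (V l)))
  obtain ⟨α, -, hα, h₁, h₂⟩ := hκ.exists_max hα₀
  obtain ⟨⟨h₃, h₄, h₅⟩, -⟩ := leastOrd_spec (P := fun β => IsSub α₀ β ∧ enum β = enum α) hα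
    ⟨h₂, rfl⟩
  have h₆ := h (enum α) (key α hα h₂).2 h₃
  rcases h₃.trichotomy hα with h' | h' | h'
  · exact (key α hα h₂).1 _ h' h₅
  · rw [h'] at h₆
    exact not_mem_self α (h₁ α h₆)
  · exact (key _ h₃ h₄).1 _ h' h₅.symm

/-- The truth sets of all formulas are enumerated. -/
theorem exists_enum_sat {l : M} (hl : IsOrd l) (ψ : PF) :
    ∃ δ, IsOrd δ ∧ ∀ s, s ε enum δ ↔ IsAsg s (V l) ∧ Sat (· ε V l) ψ s := by
  have hnum : ∀ k, IsOrd (num k : M) := fun k => (isNat_num k).1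
  have hne : ∀ i j : ℕ, (num i : M) = num j ↔ i = j := fun i j => num_injective.eq_iff
  induction ψ with
  | fal =>
    -- There is no operation number 4, so `truthOp` returns the empty set, the truth set of falsity.
    obtain ⟨δ, hδ, h⟩ := exists_enum_eq (hnum 4) hl (hnum 0) (hnum 0)
    exact ⟨δ, hδ, fun s => by rw [h, mem_truthOp]; simp [hne, Sat]⟩
  | mem i j =>
    obtain ⟨δ, hδ, h⟩ := exists_enum_eq (hnum 0) hl (hnum i) (hnum j)
    exact ⟨δ, hδ, fun s => by rw [h, mem_truthOp]; simp [hne, Sat]⟩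
  | eq i j =>
    obtain ⟨δ, hδ, h⟩ := exists_enum_eq (hnum 1) hl (hnum i) (hnum j)
    exact ⟨δ, hδ, fun s => by rw [h, mem_truthOp]; simp [hne, Sat]⟩
  | imp p q ih ih' =>
    obtain ⟨b, hb, hb'⟩ := ih
    obtain ⟨c, hc, hc'⟩ := ih'
    obtain ⟨δ, hδ, h⟩ := exists_enum_eq (hnum 2) hl hb hc
    refine ⟨δ, hδ, fun s => ?_⟩
    rw [h, mem_truthOp]
    refine and_congr_right fun hs => ?_
    simp [hne, Sat, hb', hc', hs]
  | all i p ih =>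
    obtain ⟨c, hc, hc'⟩ := ih
    -- Here `b` is the number of the quantified variable, and only `c` is an argument of the
    -- enumeration.
    obtain ⟨δ, hδ, h⟩ := exists_enum_eq (hnum 3) hl (hnum i) hc
    refine ⟨δ, hδ, fun s => ?_⟩
    rw [h, mem_truthOp]
    refine and_congr_right fun hs => ?_
    simp only [hne, Sat, hc']
    norm_num
    exact forall_congr' fun x => imp_congr_right fun hx => and_iff_right (hs.upd (isNat_num i) hx)

/-- `x` is determined by the `α`-th enumerated set. -/
def IsIndex (α x : M) : Prop := IsOrd α ∧ ∀ y, pointAsg y ε enum α ↔ y = x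

instance {t s : (ℕ → M) → M} [DfnTerm A t] [DfnTerm A s] : Dfn A fun v => IsIndex (t v) (s v) :=
  Dfn.subst₂ (by unfold IsIndex; infer_instance)

theorem IsIndex.unique {α x y : M} (h : IsIndex α x) (h' : IsIndex α y) : x = y :=
  (h'.2 x).1 ((h.2 x).2 rfl)

/-- Reflection moves the definition of `a` into some `V θ`. The truth set of the resulting formula
is listed, and `pointAsg a` is the only point assignment in it. -/
theorem exists_isIndex_of_dfn {a : M} (h : Dfn ∅ fun v => v 0 = a) : ∃ α, IsIndex α a := by
  obtain ⟨ψ, θ, hθ, h₀, ha, h⟩ := exists_pf_of_dfn h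
  obtain ⟨δ, hδ, h'⟩ := exists_enum_sat hθ ψ
  refine ⟨δ, hδ, fun y => ?_⟩
  rw [h']
  have h₀' := isSub_V hθ _ h₀
  constructor
  · rintro ⟨h₁, h₂⟩
    have := h₁.ap_mem isNat_emp
    rw [ap_pointAsg] at this
    exact (h y this).1 h₂
  · rintro rfl
    exact ⟨IsAsg.pointAsg h₀' ha, (h y ha).2 rfl⟩

end Enumeration

/-! ### From algebraic to definable, and choice -/

section Definability

variable {M : Type u} [setLang.Structure M]

theorem Dfn.mono {A B : Set M} {P : (ℕ → M) → Prop} (h : Dfn A P) (hAB : A ⊆ B) : Dfn B P := by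
  obtain ⟨φ, hφ⟩ := h.out
  refine ⟨φ.relabel (Sum.map (Set.inclusion hAB) id), fun v => ?_⟩
  rw [Formula.realize_relabel, ← hφ]
  apply iff_of_eq; congr 1; funext i; cases i <;> rfl

theorem definable₁_iff_dfn {s : Set M} :
    (∅ : Set M).Definable₁ setLang s ↔ Dfn (∅ : Set M) fun v => v 0 ∈ s := by
  unfold Set.Definable₁
  rw [Set.empty_definable_iff]
  constructor
  · rintro ⟨φ, hφ⟩
    refine ⟨φ.relabel fun _ => Sum.inr 0, fun v => ?_⟩
    rw [Formula.realize_relabel]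
    exact (Set.ext_iff.1 hφ fun _ => v 0).symm
  · rintro ⟨φ, hφ⟩
    refine ⟨φ.relabel fun _ => 0, Set.ext fun x => ?_⟩
    refine (hφ fun _ => x 0).symm.trans (Iff.symm ?_)
    refine (Formula.realize_relabel (φ := φ)).trans ?_
    apply iff_of_eq; congr 1; funext i
    rcases i with i | i
    · exact i.2.elim
    · rfl

theorem definableElement_iff_dfn {a : M} :
    DefinableElement setLang a ↔ Dfn (∅ : Set M) fun v => v 0 = a :=
  definable₁_iff_dfn

variable [hM : ZFModel M]

/-- The elements of a finite definable set `N` are definable, provided that all elements of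
elements of `N` have an index. -/
theorem dfn_of_finite {N : Set M} (hN : N.Finite) (dN : Dfn ∅ fun v => v 0 ∈ N)
    (h : ∀ x ∈ N, ∀ z, z ε x → ∃ α, IsIndex α z) {a : M} (ha : a ∈ N) :
    Dfn ∅ fun v => v 0 = a := by
  induction hn : N.ncard using Nat.strong_induction_on generalizing N with
  | _ n ih =>
  subst hn
  by_cases hs : ∀ b ∈ N, b = a
  · exact dN.congr fun v => ⟨hs (v 0), fun e => by rwa [e]⟩
  · push Not at hs
    obtain ⟨b, hb, hba⟩ := hs
    have dN' : ∀ (A : Set M) (t : (ℕ → M) → M), [DfnTerm A t] → Dfn A fun v => t v ∈ N :=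
      fun A t _ => Dfn.subst₁ (P := fun x => x ∈ N) (dN.mono (Set.empty_subset A))
    -- Some set with index `α` separates two members of `N`. The least such `α` is definable without
    -- parameters, and membership of the set it indexes divides `N` into two proper parts.
    let P : M → Prop := fun α => ∃ x y z, x ∈ N ∧ y ∈ N ∧ IsIndex α z ∧ z ε x ∧ ¬ z ε y
    have hP : ∃ α, IsOrd α ∧ P α := by
      by_contra hn
      -- By extensionality `a` and `b` differ in some `z`, which has an index as an element of a
      -- member of `N`.
      refine hba (ext fun z => ⟨fun hz => ?_, fun hz => ?_⟩)
      · by_contra hz'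
        obtain ⟨α, hα⟩ := h b hb z hz
        exact hn ⟨α, hα.1, b, a, z, hb, ha, hα, hz, hz'⟩
      · by_contra hz'
        obtain ⟨α, hα⟩ := h a ha z hz
        exact hn ⟨α, hα.1, a, b, z, ha, hb, hα, hz, hz'⟩
    obtain ⟨α, hα, hPα⟩ := hP
    obtain ⟨⟨-, x, y, z, hx, hy, hz, hzx, hzy⟩, -⟩ := leastOrd_spec hα hPα
    have dδ : DfnTerm ∅ fun _ : ℕ → M => leastOrd P := DfnTerm.leastOrd (P := fun _ => P)
    by_cases haQ : ∃ z, IsIndex (leastOrd P) z ∧ z ε a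
    · refine ih _ (Set.ncard_lt_ncard ?_ hN)
        (N := {x | x ∈ N ∧ ∃ z, IsIndex (leastOrd P) z ∧ z ε x})
        (hN.subset fun x hx => hx.1)
        (inferInstance : Dfn ∅ fun v : ℕ → M =>
          v 0 ∈ N ∧ ∃ z, IsIndex (leastOrd P) z ∧ z ε v 0)
        (fun x hx => h x hx.1) ⟨ha, haQ⟩ rfl
      refine ⟨fun x hx => hx.1, fun hsub => ?_⟩
      obtain ⟨-, z', hz', hzy'⟩ := hsub hy
      exact hzy (hz.unique hz' ▸ hzy')
    · refine ih _ (Set.ncard_lt_ncard ?_ hN)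
        (N := {x | x ∈ N ∧ ¬ ∃ z, IsIndex (leastOrd P) z ∧ z ε x})
        (hN.subset fun x hx => hx.1)
        (inferInstance : Dfn ∅ fun v : ℕ → M =>
          v 0 ∈ N ∧ ¬ ∃ z, IsIndex (leastOrd P) z ∧ z ε v 0)
        (fun x hx => h x hx.1) ⟨ha, haQ⟩ rfl
      exact ⟨fun x hx => hx.1, fun hsub => (hsub hx).2 ⟨z, hz, hzx⟩⟩

/-- A minimal set `a` without index has only indexed elements, but the other members of the finite
set witnessing its algebraicity may not. Discarding those keeps the set definable because `IsIndex`
is, and `a` turns out definable. -/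
theorem exists_isIndex (halg : PointwiseAlgebraic setLang M) (x : M) : ∃ α, IsIndex α x := by
  by_contra hx
  obtain ⟨a, ha, ha'⟩ := exists_min_of_dfn (P := fun x : M => ¬ ∃ α, IsIndex α x) hx
  obtain ⟨s, hs, hfin, has⟩ := halg a
  have ds := definable₁_iff_dfn.1 hs
  refine ha (exists_isIndex_of_dfn (dfn_of_finite
    (N := {x | x ∈ s ∧ ∀ z, z ε x → ∃ α, IsIndex α z}) (hfin.subset fun x hx => hx.1)
    (inferInstance : Dfn ∅ fun v : ℕ → M => v 0 ∈ s ∧ ∀ z, z ε v 0 → ∃ α, IsIndex α z)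
    (fun x hx => hx.2) ⟨has, fun z hz => not_not.1 (ha' z hz)⟩))

theorem dfn_of_pointwiseAlgebraic (halg : PointwiseAlgebraic setLang M) (a : M) :
    Dfn ∅ fun v => v 0 = a := by
  obtain ⟨s, hs, hfin, has⟩ := halg a
  exact dfn_of_finite hfin (definable₁_iff_dfn.1 hs) (fun _ _ z _ => exists_isIndex halg z) has

/-- The transversal takes from each set its element of least index, which is unique because an index
determines its set. -/
theorem realize_choice (h : ∀ x : M, ∃ α, IsIndex α x) : M ⊨ choice := by
  have key : ∀ a : M, (∀ x, x ε a → ∃ y, y ε x) →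
      (∀ x, x ε a → ∀ y, y ε a → ∀ z, z ε x → z ε y → x = y) →
      ∃ c, ∀ x, x ε a → ∃ z, ∀ w, (w ε x ∧ w ε c) ↔ w = z := by
    intro a h₁ h₂
    let first : M → M := fun x => leastOrd fun α => ∃ z, z ε x ∧ IsIndex α z
    have hc : ∀ z, z ε cls (fun z => ∃ x, x ε a ∧ z ε x ∧ IsIndex (first x) z) ↔
        ∃ x, x ε a ∧ z ε x ∧ IsIndex (first x) z :=
      mem_cls (sUn a) fun z ⟨x, hx, hz, _⟩ => mem_sUn.2 ⟨x, hx, hz⟩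
    refine ⟨cls fun z => ∃ x, x ε a ∧ z ε x ∧ IsIndex (first x) z, fun x hx => ?_⟩
    obtain ⟨y, hy⟩ := h₁ x hx
    obtain ⟨α, hα⟩ := h y
    obtain ⟨⟨-, z, hz, hz'⟩, -⟩ := leastOrd_spec (P := fun α => ∃ z, z ε x ∧ IsIndex α z) hα.1
      ⟨y, hy, hα⟩
    refine ⟨z, fun w => ⟨fun ⟨hw, hwc⟩ => ?_, ?_⟩⟩
    · obtain ⟨x', hx', hw', hi⟩ := (hc w).1 hwc
      obtain rfl := h₂ x hx x' hx' w hw hw'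
      exact hi.unique hz'
    · rintro rfl
      exact ⟨hz, (hc w).2 ⟨x, hx, hz, hz'⟩⟩
  change BoundedFormula.Realize choice default default
  simp [choice]
  intro a h₁ h₂
  exact key a h₁ fun x hx y hy z hzx hzy => h₂ x hx y hy z hzx hzy

end Definability

/-! ### Meaning of the formulas for ordinal definability -/

section Realize

variable {M : Type u} [setLang.Structure M] {n : ℕ} (e : Empty → M)
  (v : Fin n → M)

@[simp] theorem realize_isTrans (x : Fin n) : (isTrans x).Realize e v ↔ IsTr (v x) := by
  simp [isTrans, IsTr]

@[simp] theorem realize_isOrd (x : Fin n) : (isOrd x).Realize e v ↔ IsOrd (v x) := by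
  simp [isOrd, IsOrd]

variable [hM : ZFModel M]

theorem eq_upair_iff {x y z : M} : (∀ w, w ε z ↔ (w = x ∨ w = y)) ↔ z = upair x y :=
  ⟨fun h => ext fun w => by rw [h, mem_upair], by rintro rfl w; exact mem_upair⟩

theorem eq_succ_iff {x y : M} : (∀ w, w ε y ↔ (w ε x ∨ w = x)) ↔ y = succ x :=
  ⟨fun h => ext fun w => by rw [h, mem_succ], by rintro rfl w; exact mem_succ⟩

@[simp] theorem realize_isPair (z x y : Fin n) :
    (isPair z x y).Realize e v ↔ v z = pair (v x) (v y) := by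
  simp only [isPair, realize_ex', BoundedFormula.realize_inf, realize_isUPair, eq_upair_iff,
    Fin.snoc_castSucc, Fin.snoc_last]
  simp [pair]

@[simp] theorem realize_isZeroOrSucc (x : Fin n) :
    (isZeroOrSucc x).Realize e v ↔ ZeroOrSucc (v x) := by
  simp [isZeroOrSucc, ZeroOrSucc, eq_succ_iff, eq_emp_iff]

@[simp] theorem realize_isNat (x : Fin n) : (isNat x).Realize e v ↔ IsNat (v x) := by
  simp [isNat, IsNat]

@[simp] theorem realize_isNum (k : ℕ) (x : Fin n) : (isNum k x).Realize e v ↔ v x = num k := by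
  induction k generalizing n with
  | zero => simp [isNum, num, eq_emp_iff]
  | succ k ih => simp [isNum, num, ih, eq_succ_iff]

@[simp] theorem realize_app (r x y : Fin n) :
    (app r x y).Realize e v ↔ pair (v x) (v y) ε v r := by
  simp [app]

@[simp] theorem realize_isTriple (k : ℕ) (p x y : Fin n) :
    (isTriple k p x y).Realize e v ↔ v p = pair (num k) (pair (v x) (v y)) := by
  simp [isTriple]

@[simp] theorem realize_isAssignment (s a : Fin n) :
    (isAssignment s a).Realize e v ↔ IsAsg (v s) (v a) := by
  simp [isAssignment, IsAsg, and_left_comm]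

/-- The functions `s` and `t` agree at all natural numbers other than `i`. -/
def AgreeOff (s t i : M) : Prop :=
  ∀ j, IsNat j → j ≠ i → ∀ y, pair j y ε s ↔ pair j y ε t

@[simp] theorem realize_agreeOff (s t i : Fin n) :
    (agreeOff s t i).Realize e v ↔ AgreeOff (v s) (v t) (v i) := by
  simp [agreeOff, AgreeOff]

/-- `F` is a set of codes of formulas closed under subformulas. -/
def IsFormulaSet (F : M) : Prop :=
  ∀ p, p ε F → p = emp ∨ ∃ x y,
    ((p = pair (num 0) (pair x y) ∨ p = pair (num 1) (pair x y)) ∧ IsNat x ∧ IsNat y) ∨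
      (p = pair (num 2) (pair x y) ∧ x ε F ∧ y ε F) ∨
        (p = pair (num 3) (pair x y) ∧ IsNat x ∧ y ε F)

@[simp] theorem realize_isFormulaSet (F : Fin n) :
    (isFormulaSet F).Realize e v ↔ IsFormulaSet (v F) := by
  simp [isFormulaSet, IsFormulaSet, eq_emp_iff]

/-- `T` obeys Tarski's clauses for the structure `(a, ∈)` and the formulas with codes in `F`. -/
def IsSatRel (a F T : M) : Prop :=
  ∀ p, p ε F → ∀ s, IsAsg s a → (p = emp → ¬ pair p s ε T) ∧ ∀ x y,
    (p = pair (num 0) (pair x y) →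
      (pair p s ε T ↔ ∃ a b, pair x a ε s ∧ pair y b ε s ∧ a ε b)) ∧
    (p = pair (num 1) (pair x y) →
      (pair p s ε T ↔ ∃ a b, pair x a ε s ∧ pair y b ε s ∧ a = b)) ∧
    (p = pair (num 2) (pair x y) → (pair p s ε T ↔ (pair x s ε T → pair y s ε T))) ∧
    (p = pair (num 3) (pair x y) →
      (pair p s ε T ↔ ∀ t, IsAsg t a → AgreeOff s t x → pair y t ε T))

@[simp] theorem realize_isSatRel (a F T : Fin n) :
    (isSatRel a F T).Realize e v ↔ IsSatRel (v a) (v F) (v T) := by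
  simp only [isSatRel, IsSatRel, eq_emp_iff, realize_all', realize_ex', realize_allIn,
    BoundedFormula.realize_imp, BoundedFormula.realize_inf, BoundedFormula.realize_not,
    BoundedFormula.realize_iff, realize_isEmpty, realize_app, realize_isTriple, realize_mem,
    realize_eq, realize_isAssignment, realize_agreeOff, Fin.snoc_castSucc, Fin.snoc_last, and_imp]

/-- Satisfaction in the structure `(a, ∈)` of the formula with code `f`. -/
def CodeSat (a f s : M) : Prop :=
  ∃ F T, f ε F ∧ IsFormulaSet F ∧ IsSatRel a F T ∧ pair f s ε T

@[simp] theorem realize_sat (a f s : Fin n) :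
    (sat a f s).Realize e v ↔ CodeSat (v a) (v f) (v s) := by
  simp [sat, CodeSat]

/-- The recursion history on `succ θ` is the required function. One direction suffices, since
ordinal definability only asks that a level exist. -/
theorem realize_isV_of_eq (x θ : Fin n) (hθ : IsOrd (v θ)) (h : v x = V (v θ)) :
    (isV x θ).Realize e v := by
  simp only [isV, isFunOn, realize_all', realize_ex', realize_allIn, realize_exIn,
    BoundedFormula.realize_imp, BoundedFormula.realize_inf, BoundedFormula.realize_iff,
    realize_isOrd, realize_app, realize_mem, realize_eq, realize_isPair, realize_subset,
    Fin.snoc_castSucc, Fin.snoc_last]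
  have hd := hθ.succ
  have hm : v θ ε succ (v θ) := mem_succ.2 (Or.inr rfl)
  refine ⟨succ (v θ), hist hierStep (succ (v θ)), hd, hm, ⟨fun z hz => ?_, fun β hβ => ?_⟩,
    (pair_mem_hist hd).2 ⟨hm, h⟩, fun β hβ y hy x => ?_⟩
  · obtain ⟨β, hβ, rfl⟩ := (mem_hist hd).1 hz
    exact ⟨β, hβ, _, rfl⟩
  · exact ⟨V β, fun w => by rw [pair_mem_hist hd]; exact and_iff_right hβ⟩
  · obtain ⟨-, rfl⟩ := (pair_mem_hist hd).1 hy
    refine (mem_V (hd.mem hβ)).trans (exists_congr fun γ => and_congr_right fun hγ => ?_)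
    simp only [pair_mem_hist hd]
    constructor
    · intro h
      exact ⟨V γ, ⟨hd.1 β hβ γ hγ, rfl⟩, h⟩
    · rintro ⟨_, ⟨-, rfl⟩, h⟩
      exact h

end Realize

/-! ### Coded satisfaction and `V = HOD` -/

section Codes

variable {M : Type u} [setLang.Structure M] [hM : ZFModel M]

/-- The code of a formula. -/
noncomputable def PF.code : PF → M
  | .fal => emp
  | .mem i j => pair (num 0) (pair (num i) (num j))
  | .eq i j => pair (num 1) (pair (num i) (num j))
  | .imp p q => pair (num 2) (pair p.code q.code)
  | .all i p => pair (num 3) (pair (num i) p.code)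

theorem num_inj {i j : ℕ} : (num i : M) = num j ↔ i = j := num_injective.eq_iff

theorem PF.code_injective : Function.Injective (PF.code : PF → M) := by
  intro p
  induction p with
  | fal => rintro (_ | _) h <;> simp [code, pair_ne_emp.symm] at h ⊢
  | mem i j =>
    rintro (_ | _) h <;> simp [code, pair_ne_emp, num_inj] at h ⊢
    exact h
  | eq i j =>
    rintro (_ | _) h <;> simp [code, pair_ne_emp, num_inj] at h ⊢
    exact h
  | imp p q ih ih' =>
    rintro (_ | _) h <;> simp [code, pair_ne_emp, num_inj] at h ⊢
    exact ⟨ih h.1, ih' h.2⟩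
  | all i p ih =>
    rintro (_ | _) h <;> simp [code, pair_ne_emp, num_inj] at h ⊢
    exact ⟨h.1, ih h.2⟩

/-- The list of subformulas. -/
def PF.sub : PF → List PF
  | .imp p q => .imp p q :: (p.sub ++ q.sub)
  | .all i p => .all i p :: p.sub
  | p => [p]

theorem PF.self_mem_sub (p : PF) : p ∈ p.sub := by
  cases p <;> simp [sub]

theorem PF.imp_mem_sub {p q r : PF} (h : PF.imp p q ∈ r.sub) : p ∈ r.sub ∧ q ∈ r.sub := by
  induction r with
  | fal => simp [sub] at h
  | mem => simp [sub] at h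
  | eq => simp [sub] at h
  | imp r s ih ih' =>
    simp only [sub, List.mem_cons, List.mem_append] at h ⊢
    rcases h with h | h | h
    · obtain ⟨rfl, rfl⟩ := PF.imp.inj h
      simp [self_mem_sub]
    · have := ih h; tauto
    · have := ih' h; tauto
  | all i r ih =>
    simp only [sub, List.mem_cons] at h ⊢
    have := ih (h.resolve_left (by simp))
    tauto

theorem PF.all_mem_sub {i : ℕ} {p r : PF} (h : PF.all i p ∈ r.sub) : p ∈ r.sub := by
  induction r with
  | fal => simp [sub] at h
  | mem => simp [sub] at h
  | eq => simp [sub] at h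
  | imp r s ih ih' =>
    simp only [sub, List.mem_cons, List.mem_append] at h ⊢
    rcases h with h | h | h
    · simp at h
    · exact Or.inr (Or.inl (ih h))
    · exact Or.inr (Or.inr (ih' h))
  | all j r ih =>
    simp only [sub, List.mem_cons] at h ⊢
    rcases h with h | h
    · obtain ⟨rfl, rfl⟩ := PF.all.inj h
      simp [self_mem_sub]
    · exact Or.inr (ih h)

/-- The variants of `s` at `i` are exactly its updates at `i`, so Tarski's clause for quantifiers
matches the one in `Sat`. -/
theorem forall_agreeOff_iff {a s i : M} {P : M → Prop} (hs : IsAsg s a) (hi : IsNat i) :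
    (∀ t, IsAsg t a → AgreeOff s t i → P t) ↔ ∀ x, x ε a → P (upd s i x) := by
  constructor
  · intro h x hx
    refine h _ (hs.upd hi hx) fun j _ hji y => ?_
    rw [pair_mem_upd]
    simp [hji]
  · intro h t ht hst
    have : t = upd s i (ap t i) := by
      refine ht.ext (hs.upd hi (ht.ap_mem hi)) fun j hj => ?_
      by_cases hji : j = i
      · rw [hji, ap_upd_self]
      · rw [ap_upd_of_ne hji]
        exact (hs.pair_mem hj).1 ((hst j hj hji _).2 ((ht.pair_mem hj).2 rfl))
    rw [this]
    exact h _ (ht.ap_mem hi)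

theorem IsAsg.exists_pair_iff {a s i j : M} {R : M → M → Prop} (hs : IsAsg s a) (hi : IsNat i)
    (hj : IsNat j) : (∃ x y, pair i x ε s ∧ pair j y ε s ∧ R x y) ↔ R (ap s i) (ap s j) := by
  simp only [hs.pair_mem hi, hs.pair_mem hj]
  constructor
  · rintro ⟨_, _, rfl, rfl, h⟩
    exact h
  · intro h
    exact ⟨_, _, rfl, rfl, h⟩

/-- All satisfaction relations agree with satisfaction. -/
theorem IsSatRel.pair_code_mem {a F T : M} (hF : IsFormulaSet F) (hT : IsSatRel a F T) (ψ : PF)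
    (hψ : ψ.code ε F) {s : M} (hs : IsAsg s a) : pair ψ.code s ε T ↔ Sat (· ε a) ψ s := by
  -- Induction on the external formula suffices: nonstandard codes in `F` are never reached from a
  -- standard one.
  induction ψ generalizing s with
  | fal => simpa [Sat] using (hT _ hψ s hs).1 rfl
  | mem i j =>
    rw [((hT _ hψ s hs).2 (num i) (num j)).1 rfl, hs.exists_pair_iff (isNat_num i) (isNat_num j)]
    rfl
  | eq i j =>
    rw [((hT _ hψ s hs).2 (num i) (num j)).2.1 rfl, hs.exists_pair_iff (isNat_num i) (isNat_num j)]
    rfl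
  | imp p q ih ih' =>
    have : p.code ε F ∧ q.code ε F := by
      rcases hF _ hψ with h | ⟨x, y, h⟩
      · exact absurd h pair_ne_emp
      · simp [PF.code, num_inj] at h
        obtain ⟨⟨rfl, rfl⟩, h⟩ := h
        exact h
    rw [((hT _ hψ s hs).2 p.code q.code).2.2.1 rfl, ih this.1 hs, ih' this.2 hs]
    rfl
  | all i p ih =>
    have : p.code ε F := by
      rcases hF _ hψ with h | ⟨x, y, h⟩
      · exact absurd h pair_ne_emp
      · simp [PF.code, num_inj] at h
        obtain ⟨⟨rfl, rfl⟩, -, h⟩ := h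
        exact h
    rw [((hT _ hψ s hs).2 (num i) p.code).2.2.2 rfl, forall_agreeOff_iff hs (isNat_num i)]
    exact forall_congr' fun x => imp_congr_right fun hx => ih this (hs.upd (isNat_num i) hx)

/-- The list is external, so both sets arise from finitely many unions, without recursion on codes
inside `M`. -/
theorem exists_codes_and_sat (a : M) (l : List PF) :
    ∃ F T : M, (∀ p, p ε F ↔ ∃ χ ∈ l, p = χ.code) ∧
      ∀ z, z ε T ↔ ∃ χ ∈ l, ∃ s, IsAsg s a ∧ Sat (· ε a) χ s ∧ z = pair χ.code s := by
  induction l with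
  | nil => exact ⟨emp, emp, by simp, by simp⟩
  | cons χ l ih =>
    obtain ⟨F, T, hF, hT⟩ := ih
    have hc : ∀ s, s ε cls (fun s => IsAsg s a ∧ Sat (· ε a) χ s) ↔
        IsAsg s a ∧ Sat (· ε a) χ s := mem_cls (asg a) fun s h => mem_asg.2 h.1
    refine ⟨cup (upair χ.code χ.code) F, cup (image (fun s => pair χ.code s)
      (cls fun s => IsAsg s a ∧ Sat (· ε a) χ s)) T, by simp [hF], fun z => ?_⟩
    simp [hT, hc, and_assoc]

theorem exists_isSatRel (a : M) (ψ : PF) :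
    ∃ F T, ψ.code ε F ∧ IsFormulaSet F ∧ IsSatRel a F T := by
  obtain ⟨F, T, hF, hT⟩ := exists_codes_and_sat a ψ.sub
  have hT' : ∀ χ ∈ ψ.sub, ∀ s, IsAsg s a → (pair χ.code s ε T ↔ Sat (· ε a) χ s) := by
    intro χ hχ s hs
    rw [hT]
    constructor
    · rintro ⟨χ', -, s', -, h, e⟩
      obtain ⟨hc, rfl⟩ := pair_inj.1 e
      rwa [PF.code_injective hc]
    · intro h
      exact ⟨χ, hχ, s, hs, h, rfl⟩
  refine ⟨F, T, (hF _).2 ⟨ψ, ψ.self_mem_sub, rfl⟩, fun p hp => ?_, fun p hp s hs => ?_⟩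
  · obtain ⟨χ, hχ, rfl⟩ := (hF p).1 hp
    cases χ with
    | fal => exact Or.inl rfl
    | mem i j => exact Or.inr ⟨num i, num j, Or.inl ⟨Or.inl rfl, isNat_num i, isNat_num j⟩⟩
    | eq i j => exact Or.inr ⟨num i, num j, Or.inl ⟨Or.inr rfl, isNat_num i, isNat_num j⟩⟩
    | imp p q =>
      obtain ⟨h₁, h₂⟩ := PF.imp_mem_sub hχ
      exact Or.inr ⟨p.code, q.code, Or.inr (Or.inl ⟨rfl, (hF _).2 ⟨p, h₁, rfl⟩,
        (hF _).2 ⟨q, h₂, rfl⟩⟩)⟩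
    | all i p =>
      exact Or.inr ⟨num i, p.code, Or.inr (Or.inr ⟨rfl, isNat_num i,
        (hF _).2 ⟨p, PF.all_mem_sub hχ, rfl⟩⟩)⟩
  · obtain ⟨χ, hχ, rfl⟩ := (hF p).1 hp
    rw [hT' χ hχ s hs]
    cases χ with
    | fal => simp [PF.code, Sat, pair_ne_emp.symm]
    | mem i j =>
      refine ⟨fun h => absurd h pair_ne_emp, fun x y => ?_⟩
      simp only [PF.code, pair_inj, num_inj]
      refine ⟨?_, by norm_num, by norm_num, by norm_num⟩
      rintro ⟨-, rfl, rfl⟩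
      exact (hs.exists_pair_iff (isNat_num i) (isNat_num j)).symm
    | eq i j =>
      refine ⟨fun h => absurd h pair_ne_emp, fun x y => ?_⟩
      simp only [PF.code, pair_inj, num_inj]
      refine ⟨by norm_num, ?_, by norm_num, by norm_num⟩
      rintro ⟨-, rfl, rfl⟩
      exact (hs.exists_pair_iff (R := Eq) (isNat_num i) (isNat_num j)).symm
    | imp p q =>
      obtain ⟨h₁, h₂⟩ := PF.imp_mem_sub hχ
      refine ⟨fun h => absurd h pair_ne_emp, fun x y => ?_⟩
      simp only [PF.code, pair_inj, num_inj]
      norm_num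
      rintro rfl rfl
      rw [hT' p h₁ s hs, hT' q h₂ s hs]
      rfl
    | all i p =>
      refine ⟨fun h => absurd h pair_ne_emp, fun x y => ?_⟩
      simp only [PF.code, pair_inj, num_inj]
      norm_num
      rintro rfl rfl
      rw [forall_agreeOff_iff hs (isNat_num i)]
      exact forall_congr' fun x => imp_congr_right fun hx =>
        (hT' p (PF.all_mem_sub hχ) _ (hs.upd (isNat_num i) hx)).symm

theorem codeSat_code_iff {a s : M} (ψ : PF) (hs : IsAsg s a) :
    CodeSat a ψ.code s ↔ Sat (· ε a) ψ s := by
  constructor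
  · rintro ⟨F, T, h₁, h₂, h₃, h₄⟩
    exact (h₃.pair_code_mem h₂ ψ h₁ hs).1 h₄
  · intro h
    obtain ⟨F, T, h₁, h₂, h₃⟩ := exists_isSatRel a ψ
    exact ⟨F, T, h₁, h₂, h₃, (h₃.pair_code_mem h₂ ψ h₁ hs).2 h⟩

/-- Definable elements of `M` are ordinal definable in `M`. -/
theorem realize_isOD_of_dfn {n : ℕ} (e : Empty → M) (v : Fin n → M) (a : Fin n)
    (h : Dfn ∅ fun w => w 0 = v a) : (isOD a).Realize e v := by
  obtain ⟨ψ, θ, hθ, h₀, ha, h⟩ := exists_pf_of_dfn h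
  simp only [isOD, realize_ex', realize_all', BoundedFormula.realize_inf,
    BoundedFormula.realize_imp, BoundedFormula.realize_iff, realize_isOrd, realize_isAssignment,
    realize_mem, realize_isEmpty, realize_agreeOff, realize_sat, realize_app, Fin.snoc_castSucc,
    Fin.snoc_last]
  -- No ordinal parameters are needed, so all of them are set to zero; `emp ε θ` makes this an
  -- assignment in `θ`.
  refine ⟨θ, V θ, ψ.code, zeroAsg, hθ, realize_isV_of_eq _ _ _ _ (by simpa using hθ) (by simp),
    isAsg_zeroAsg h₀, ?_, ha, ?_⟩
  · simp only [finSupport, realize_ex', realize_all', BoundedFormula.realize_inf,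
      BoundedFormula.realize_imp, realize_isNat, BoundedFormula.realize_not, realize_mem,
      realize_app, realize_isEmpty, Fin.snoc_castSucc, Fin.snoc_last]
    refine ⟨emp, isNat_emp, fun i y hy => ?_⟩
    rw [(pair_mem_zeroAsg.1 hy.2.2).2]
    exact not_mem_emp
  · rintro o t ⟨ho, ht, hot⟩
    obtain rfl := eq_emp ho
    have h₀' := isSub_V hθ _ h₀
    revert t
    suffices ∀ t, IsAsg t (V θ) → AgreeOff zeroAsg t emp →
      (CodeSat (V θ) ψ.code t ↔ pair emp (v a) ε t) from fun t h₁ h₂ => this t h₁ h₂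
    -- The assignments that agree with zero away from variable 0 are the point assignments, for
    -- which `ψ` defines the element.
    rw [forall_agreeOff_iff (isAsg_zeroAsg h₀') isNat_emp]
    intro y hy
    change CodeSat (V θ) ψ.code (pointAsg y) ↔ pair emp (v a) ε pointAsg y
    have hs := IsAsg.pointAsg h₀' hy
    rw [codeSat_code_iff ψ hs, h y hy, hs.pair_mem isNat_emp, ap_pointAsg, eq_comm]

theorem realize_VeqHOD (h : ∀ a : M, Dfn ∅ fun v => v 0 = a) : M ⊨ VeqHOD := by
  change BoundedFormula.Realize VeqHOD default default
  simp only [VeqHOD, isHOD, realize_all', realize_ex', BoundedFormula.realize_inf, realize_isTrans,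
    realize_mem, realize_allIn, Fin.snoc_castSucc, Fin.snoc_last]
  intro a
  obtain ⟨t, ht, hat⟩ := exists_isTr a
  exact ⟨t, ht, hat, fun x _ => realize_isOD_of_dfn _ _ _ (h _)⟩

end Codes

end SetModel

theorem theorem2 {M : Type*} [SetModel.setLang.Structure M]
    (hZF : M ⊨ SetModel.ZF) (halg : SetModel.PointwiseAlgebraic SetModel.setLang M) :
    SetModel.PointwiseDefinable SetModel.setLang M ∧
      M ⊨ (SetModel.ZFC ∪ {SetModel.VeqHOD} : SetModel.setLang.Theory) := by
  have : SetModel.ZFModel M := ⟨hZF⟩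
  have hdfn := SetModel.dfn_of_pointwiseAlgebraic halg
  refine ⟨fun a => SetModel.definableElement_iff_dfn.2 (hdfn a), ⟨fun σ hσ => ?_⟩⟩
  rcases hσ with (hσ | rfl) | rfl
  · exact hZF.realize_of_mem σ hσ
  · exact SetModel.realize_choice (SetModel.exists_isIndex halg)
  · exact SetModel.realize_VeqHOD hdfn
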